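/- For integers $p,q,r\ge 1$ let $T(p,q,r)=\langle x,y,z \mid x^p=y^q=z^r=xyz=1\rangle$ denote the triangle group. For every integer $n\ge 3$ with $n\notin\{5,6,8\}$, the hyperoctahedral group $B_n=\mathbb{Z}_2\wr\Sigma_n=(\mathbb{Z}_2)^n\rtimes\Sigma_n$ (where the symmetric group $\Sigma_n$ permutes the coordinates) is a quotient of the triangle group $T(2,4,6)$; moreover, $B_n$ has a $(2,4,6)$ generating pair, that is, it is generated by two elements of orders exactly $2$ and $4$ whose product has order exactly $6$. In the exceptional cases, $B_5$, $B_6$ and $B_8$ are quotients of the triangle groups $T(2,4,10)$, $T(2,6,6)$ and $T(2,4,8)$ respectively. -/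

import Mathlib

/-- The hyperoctahedral group `B_n = ℤ₂ ≀ Σ_n`: the semidirect product of `(ℤ₂)^n` (written
multiplicatively) by the symmetric group on `n` letters, which acts by permuting coordinates,
`(σ • b) i = b (σ⁻¹ i)`. -/
abbrev Hyperoctahedral (n : ℕ) : Type :=
  (Fin n → Multiplicative (ZMod 2)) ⋊[mulAutArrow] Equiv.Perm (Fin n)

/-- The three generators of a triangle group. -/
inductive TriangleGen : Type
  | x
  | y
  | z

/-- The relators `x ^ p`, `y ^ q`, `z ^ r` and `x y z`. -/
def triangleRels (p q r : ℕ) : Set (FreeGroup TriangleGen) :=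
  {FreeGroup.of TriangleGen.x ^ p, FreeGroup.of TriangleGen.y ^ q, FreeGroup.of TriangleGen.z ^ r,
    FreeGroup.of TriangleGen.x * FreeGroup.of TriangleGen.y * FreeGroup.of TriangleGen.z}

/-- The triangle group `T(p,q,r) = ⟨x, y, z | x ^ p = y ^ q = z ^ r = x y z = 1⟩`. -/
abbrev TriangleGroup (p q r : ℕ) : Type :=
  PresentedGroup (triangleRels p q r)

/-- `G` is a quotient of `T`: there is a surjective homomorphism from `T` onto `G`. -/
def IsQuotientOf (G T : Type*) [Group G] [Group T] : Prop :=
  ∃ f : T →* G, Function.Surjective f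

/-- `G` has a `(p,q,r)` generating pair: generators `x`, `y` of orders exactly `p` and `q` whose
product `x y` has order exactly `r`. -/
def HasGeneratingPair (G : Type*) [Group G] (p q r : ℕ) : Prop :=
  ∃ x y : G, Subgroup.closure {x, y} = ⊤ ∧ orderOf x = p ∧ orderOf y = q ∧ orderOf (x * y) = r

/-! Elements of `Bₙ` are signed permutations, and explicit generators are exhibited for every `n`;
what has to be proved is that the group `G` they generate is all of `Bₙ`.

Image in `Σₙ`: `G` acts transitively, and a power of a short word in the generators is a cycle of
prime length `p` whose support meets its images under both generators. This forces primitivity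
(`isPreprimitive_of_isCycle`), Jordan's theorem gives the alternating group
(`alternatingGroup_le_of_isCycle_of_prime`), and an odd generator gives the rest.

Kernel: one non-constant sign vector in `G` yields, by conjugation, all vectors with product `1`.
The remaining index `2` is excluded because the signature and the product of signs are independent
on `G` (`eq_top_of_map_eq_top`). For `n ≥ 5` the non-constant vector is obtained by commutators from
an element fixing two letters with opposite signs (`exists_left_ne_of_fixed`).

Infinitely many `n`: the generators are chains made of a head, `m` equal blocks of six letters and a
tail, one chain for each residue class modulo `6`. Apart from the signature and the product of
signs, to which blocks contribute trivially, all conditions concern the path of a letter under a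
short word, and so depend on neighbouring blocks only. A chain with three blocks already shows every
local situation, and one finite computation settles all `m ≥ 3` (`exists_generators_chain`). Shorter
chains and sporadic degrees are computed directly. -/

open MulAction Equiv Equiv.Perm Pointwise

/-! ### Primitive permutation groups and Jordan's theorem. -/

/-- A transitive permutation group generated by `x` and `y` is primitive as soon as it contains an
element `c` of prime order acting as a single cycle whose support meets its images under `x` and
under `y`. -/
theorem isPreprimitive_of_isCycle {α : Type*} [Fintype α] [DecidableEq α] {x y c : Perm α}
    [IsPretransitive (Subgroup.closure {x, y}) α] (hcmem : c ∈ Subgroup.closure {x, y})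
    (hc : c.IsCycle) (hp : (orderOf c).Prime)
    (hx : ∃ a, c a ≠ a ∧ c (x a) ≠ x a) (hy : ∃ a, c a ≠ a ∧ c (y a) ≠ y a) :
    IsPreprimitive (Subgroup.closure {x, y}) α := by
  obtain ⟨a, ha, hxa⟩ := hx
  obtain ⟨b, hb, hyb⟩ := hy
  refine IsPreprimitive.of_isTrivialBlock_base a fun {B} haB hB => ?_
  by_cases hsub : B.Subsingleton
  · exact Or.inl hsub
  right
  obtain ⟨e, heB, hea⟩ : ∃ e ∈ B, e ≠ a := by
    by_contra! h
    exact hsub fun u hu v hv => (h u hu).trans (h v hv).symm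
  let G := Subgroup.closure {x, y}
  have mem_of : ∀ g ∈ G, ∀ u ∈ B, g u ∈ B → ∀ v ∈ B, g v ∈ B := by
    intro g hg u hu hgu v hv
    have := isBlock_iff_smul_eq_of_mem.mp hB (g := (⟨g, hg⟩ : G)) hu hgu
    rw [← this]
    exact Set.smul_mem_smul_set (a := (⟨g, hg⟩ : G)) hv
  -- If `c` moved the block `B` off itself, it would move `e` too, so `e = c ^ k a` with `k` prime
  -- to the order of `c`. Then `c ^ k` preserves `B`, and so does its power `c`.
  have hcB : c a ∈ B := by
    by_contra hca
    have hce : c e ≠ e := fun h => hca (mem_of c hcmem e heB (h.symm ▸ heB) a haB)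
    obtain ⟨k, hk⟩ := hc.exists_pow_eq ha hce
    have hkp : ¬ orderOf c ∣ k := by
      intro hdvd
      rw [orderOf_dvd_iff_pow_eq_one.mp hdvd] at hk
      exact hea hk.symm
    have hcop : Nat.Coprime k (orderOf c) := ((Nat.Prime.coprime_iff_not_dvd hp).2 hkp).symm
    obtain ⟨l, hl⟩ := exists_pow_eq_self_of_coprime hcop
    have hstep : ∀ v ∈ B, (c ^ k) v ∈ B :=
      mem_of _ (Subgroup.pow_mem _ hcmem k) a haB (hk.symm ▸ heB)
    have hall : ∀ j : ℕ, ((c ^ k) ^ j) a ∈ B := by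
      intro j
      induction j with
      | zero => simpa using haB
      | succ j ih => rw [pow_succ', Perm.mul_apply]; exact hstep _ ih
    exact hca (hl ▸ hall l)
  have hcpow : ∀ j : ℕ, (c ^ j) a ∈ B := by
    intro j
    induction j with
    | zero => simpa using haB
    | succ j ih => rw [pow_succ', Perm.mul_apply]; exact mem_of c hcmem a haB hcB _ ih
  have hsupp : ∀ v, c v ≠ v → v ∈ B := by
    intro v hv
    obtain ⟨k, hk⟩ := hc.exists_pow_eq ha hv
    exact hk ▸ hcpow k
  -- `B` contains the support of `c`, hence meets its images under both generators and is preserved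
  -- by them.
  have hinv : ∀ g ∈ G, ∀ v ∈ B, g v ∈ B := by
    intro g hg
    induction hg using Subgroup.closure_induction with
    | mem g hg =>
      have hgG : g ∈ G := Subgroup.subset_closure hg
      rcases hg with rfl | rfl
      · exact mem_of _ hgG a haB (hsupp _ hxa)
      · exact mem_of _ hgG b (hsupp _ hb) (hsupp _ hyb)
    | one => simp
    | mul g h _ _ hg hh => intro v hv; exact hg _ (hh v hv)
    | inv g hg ih =>
      intro v hv
      exact mem_of g⁻¹ (Subgroup.inv_mem _ hg) (g v) (ih v hv) (by simpa using hv) v hv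
  refine Set.eq_univ_of_forall fun v => ?_
  obtain ⟨g, hg⟩ := exists_smul_eq (Subgroup.closure {x, y}) a v
  exact hg ▸ hinv g g.2 a haB

/-- The commutator of two cycles whose supports meet in exactly one point is a three-cycle. -/
theorem isThreeCycle_of_support_inter {α : Type*} [Fintype α] [DecidableEq α] {c d : Perm α} {a : α}
    (hca : c a ≠ a) (hda : d a ≠ a) (h : ∀ v, c v ≠ v → d v ≠ v → v = a) :
    (c * d * c⁻¹ * d⁻¹).IsThreeCycle := by
  have hc : ∀ v, d v ≠ v → v ≠ a → c v = v := fun v hv hva => by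
    by_contra hcv
    exact hva (h v hcv hv)
  have hd : ∀ v, c v ≠ v → v ≠ a → d v = v := fun v hv hva => by
    by_contra hdv
    exact hva (h v hv hdv)
  have hdca : d (c a) = c a := hd _ (fun e => hca (c.injective e)) hca
  have hcda : c (d a) = d a := hc _ (fun e => hda (d.injective e)) hda
  have hne : c a ≠ d a := by
    intro e
    rw [← e] at hcda
    exact hca (c.injective hcda)
  have key : c * d * c⁻¹ * d⁻¹ = swap a (d a) * swap a (c a) := by
    rw [mul_inv_eq_iff_eq_mul, mul_inv_eq_iff_eq_mul]
    ext v
    simp only [Perm.mul_apply]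
    by_cases hva : v = a
    · subst hva
      rw [hcda, hdca, swap_apply_right, swap_apply_left]
    by_cases hcv : c v = v
    · rw [hcv]
      have h1 : d v ≠ a → c (d v) = d v := by
        intro hdva
        by_cases hdv : d v = v
        · rw [hdv, hcv]
        · exact hc _ (fun e => hdv (d.injective e)) hdva
      by_cases hdva : d v = a
      · rw [hdva, swap_apply_left, swap_apply_of_ne_of_ne hca hne]
      · rw [h1 hdva]
        by_cases hdvc : d v = c a
        · rw [← hdca] at hdvc
          exact absurd hcv ((d.injective hdvc) ▸ fun e => hca (c.injective e))
        rw [swap_apply_of_ne_of_ne hdva hdvc, swap_apply_of_ne_of_ne hdva]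
        exact fun e => hva (d.injective e)
    · rw [hd v hcv hva]
      by_cases hcva : c v = a
      · rw [hcva, swap_apply_of_ne_of_ne hda hne.symm, swap_apply_right]
      · have hccv : c (c v) ≠ c v := fun e => hcv (c.injective e)
        rw [hd _ hccv hcva, swap_apply_of_ne_of_ne hcva (fun e => hva (c.injective e)),
          swap_apply_of_ne_of_ne hcva]
        intro e
        rw [e] at hccv
        exact hccv hcda
  rw [key]
  exact isThreeCycle_swap_mul_swap_same hda.symm hca.symm hne.symm

/-- Jordan: a primitive permutation group of degree at least `2p - 1` containing a `p`-cycle, with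
`p` prime, contains the alternating group. -/
theorem alternatingGroup_le_of_isCycle_of_prime {α : Type*} [Fintype α] [DecidableEq α]
    {G : Subgroup (Perm α)} (hG : IsPreprimitive G α) {c : Perm α} (hcG : c ∈ G) (hc : c.IsCycle)
    {p : ℕ} (hp : p.Prime) (hcp : c.support.card = p) (hpα : 2 * p ≤ Fintype.card α + 1)
    (hlt : p < Fintype.card α) : alternatingGroup α ≤ G := by
  obtain ⟨k, hk⟩ : ∃ k, Fintype.card α = p + (k + 1) :=
    ⟨Fintype.card α - p - 1, by omega⟩
  -- The pointwise stabilizer of the `k + 1` fixed points of `c` contains `c`, so it is transitive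
  -- on the `p` remaining points, and primitive since `p` is prime.
  have hmp : IsMultiplyPreprimitive G α (k + 2) := by
    have htr := isPretransitive_of_isCycle_mem hc hcG
    refine hG.isMultiplyPreprimitive (s := (c.support : Set α)ᶜ) ?_ ?_ ?_
    · apply Nat.add_left_cancel
      rw [Set.ncard_add_ncard_compl, Set.ncard_coe_finset, hcp, Nat.card_eq_fintype_card, hk]
    · rw [Nat.card_eq_fintype_card, hk]
      have := hp.two_le
      omega
    · apply IsPreprimitive.of_prime_card
      convert hp
      rw [← hcp, ← Nat.card_eq_finsetCard]
      exact Nat.card_congr (Equiv.subtypeEquivRight fun v => by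
        simp [SubMulAction.mem_ofFixingSubgroup_iff])
  have hmt : IsMultiplyPretransitive G α (k + 2) :=
      IsMultiplyPreprimitive.isMultiplyPretransitive ..
  have hmt' : IsMultiplyPretransitive G α p := by
    refine isMultiplyPretransitive_of_le (n := k + 2) (by omega) ?_
    have := hp.two_le
    rw [Nat.card_eq_fintype_card]
    omega
  obtain ⟨a, ha⟩ := hc.nonempty_support
  -- a set of `p` points meeting the support of `c` only in `a`
  have hcard : (insert a c.supportᶜ).card = k + 2 := by
    rw [Finset.card_insert_of_notMem (by simpa using ha), Finset.card_compl, hcp, hk]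
    omega
  obtain ⟨T, haT, hT, hTp⟩ := Finset.exists_subsuperset_card_eq
    (s := {a}) (t := insert a c.supportᶜ) (n := p) (by simp) (by simpa using hp.one_le)
    (by omega)
  obtain ⟨e₁⟩ : Nonempty (Fin p ≃ c.support) :=
    Fintype.card_eq.mp (by simp only [Fintype.card_fin, Fintype.card_coe, hcp])
  obtain ⟨e₂⟩ : Nonempty (Fin p ≃ T) := Fintype.card_eq.mp (by simp [hTp])
  obtain ⟨g, hg⟩ := exists_smul_eq G (e₁.toEmbedding.trans (Function.Embedding.subtype _))
    (e₂.toEmbedding.trans (Function.Embedding.subtype _))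
  have hgT : ∀ v, v ∈ T ↔ (g : Perm α)⁻¹ v ∈ c.support := by
    have hstep : ∀ i, (g : Perm α) (e₁ i) = e₂ i := fun i => DFunLike.congr_fun hg i
    intro v
    constructor
    · intro hv
      have := hstep (e₂.symm ⟨v, hv⟩)
      rw [e₂.apply_symm_apply] at this
      have h' : (g : Perm α)⁻¹ v = e₁ (e₂.symm ⟨v, hv⟩) := by
        rw [Perm.inv_eq_iff_eq, this]
      exact h' ▸ (e₁ _).2
    · intro hv
      have := hstep (e₁.symm ⟨_, hv⟩)
      rw [e₁.apply_symm_apply] at this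
      have h' : v = e₂ (e₁.symm ⟨_, hv⟩) := by
        rw [← this]
        exact (Perm.inv_eq_iff_eq.1 rfl)
      exact h' ▸ (e₂ _).2
  set d : Perm α := g * c * (g : Perm α)⁻¹ with hd
  have hdsupp : ∀ v, d v ≠ v ↔ v ∈ T := by
    intro v
    rw [hgT, Perm.mem_support, hd]
    simp only [Perm.mul_apply, ne_eq, not_iff_not]
    exact Perm.eq_inv_iff_eq.symm
  have h3 : (c * d * c⁻¹ * d⁻¹).IsThreeCycle := by
    refine isThreeCycle_of_support_inter (a := a) (by simpa using ha)
      ((hdsupp a).2 (haT (by simp))) ?_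
    intro v hcv hdv
    have := hT ((hdsupp v).1 hdv)
    rcases Finset.mem_insert.1 this with h | h
    · exact h
    · simp [hcv] at h
  have hdG : d ∈ G := G.mul_mem (G.mul_mem g.2 hcG) (G.inv_mem g.2)
  exact alternatingGroup_le_of_isPreprimitive_of_isThreeCycle_mem hG h3
    (G.mul_mem (G.mul_mem (G.mul_mem hcG hdG) (G.inv_mem hcG)) (G.inv_mem hdG))

/-! ### Subgroups of `Bₙ` that map onto `Σₙ`. -/

namespace Hyperoctahedral

variable {n : ℕ}

theorem sign_mul_self (s : Multiplicative (ZMod 2)) : s * s = 1 := by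
  revert s; decide

theorem sign_mul_ne_one {s t : Multiplicative (ZMod 2)} (hs : s ≠ 1) (ht : t ≠ 1) : s * t = 1 := by
  revert s t; decide

/-- The sign with which a signed permutation moves the letter `i`. -/
def signAt (g : Hyperoctahedral n) (i : Fin n) : Multiplicative (ZMod 2) :=
  g.left (g.right i)

theorem left_mul_apply (g h : Hyperoctahedral n) (i : Fin n) :
    (g * h).left i = g.left i * h.left (g.right⁻¹ i) := rfl

theorem signAt_mul (g h : Hyperoctahedral n) (i : Fin n) :
    signAt (g * h) i = signAt g (h.right i) * signAt h i := by
  simp [signAt, left_mul_apply]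

theorem signAt_one (i : Fin n) : signAt (1 : Hyperoctahedral n) i = 1 := rfl

theorem ext_signAt {g h : Hyperoctahedral n} (hr : ∀ i, g.right i = h.right i)
    (hs : ∀ i, signAt g i = signAt h i) : g = h := by
  have hr' : g.right = h.right := Equiv.ext hr
  refine SemidirectProduct.ext ?_ hr'
  funext i
  have := hs (g.right⁻¹ i)
  simpa [signAt, ← hr'] using this

/-- The product of all signs of a signed permutation. -/
def prodSign (n : ℕ) : Hyperoctahedral n →* Multiplicative (ZMod 2) :=
  MonoidHom.mk' (fun g => ∏ i, g.left i) fun g h => by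
    simp only [left_mul_apply, Finset.prod_mul_distrib]
    congr 1
    exact Equiv.prod_comp (g.right⁻¹) h.left

theorem prodSign_apply (g : Hyperoctahedral n) : prodSign n g = ∏ i, signAt g i :=
  (Equiv.prod_comp g.right g.left).symm

theorem conj_inl (g : Hyperoctahedral n) (b : Fin n → Multiplicative (ZMod 2)) :
    g * SemidirectProduct.inl b * g⁻¹ =
      (SemidirectProduct.inl fun k => b (g.right⁻¹ k) : Hyperoctahedral n) := by
  rw [mul_inv_eq_iff_eq_mul]
  refine SemidirectProduct.ext ?_ (by simp)
  funext k
  rw [left_mul_apply, left_mul_apply]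
  simp [mul_comm]

theorem exists_mem_right_eq {G : Subgroup (Hyperoctahedral n)}
    (hG : G.map SemidirectProduct.rightHom = ⊤) (σ : Perm (Fin n)) : ∃ g ∈ G, g.right = σ := by
  have : σ ∈ G.map SemidirectProduct.rightHom := hG ▸ Subgroup.mem_top σ
  exact this

theorem eq_inl_of_right_eq_one {g : Hyperoctahedral n} (h : g.right = 1) :
    g = SemidirectProduct.inl g.left :=
  SemidirectProduct.ext rfl h

/-- A subgroup of `Bₙ` mapping onto `Σₙ` that contains a sign vector with two distinct signs
contains all products of two sign changes. -/
theorem inl_mulSingle_mul_mulSingle_mem {G : Subgroup (Hyperoctahedral n)}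
    (hG : G.map SemidirectProduct.rightHom = ⊤)
    (hv : ∃ v ∈ G, v.right = 1 ∧ ∃ i j, v.left i ≠ v.left j)
    (k l : Fin n) (s : Multiplicative (ZMod 2)) :
    (SemidirectProduct.inl (Pi.mulSingle k s * Pi.mulSingle l s) : Hyperoctahedral n) ∈ G := by
  have hconj : ∀ (σ : Perm (Fin n)) b, (SemidirectProduct.inl b : Hyperoctahedral n) ∈ G →
      (SemidirectProduct.inl (fun k => b (σ k)) : Hyperoctahedral n) ∈ G := by
    intro σ b hb
    obtain ⟨g, hg, hσ⟩ := exists_mem_right_eq hG σ⁻¹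
    have := G.mul_mem (G.mul_mem hg hb) (G.inv_mem hg)
    rwa [conj_inl, hσ, inv_inv] at this
  obtain ⟨v, hvG, hv1, i, j, hij⟩ := hv
  have hne : i ≠ j := fun h => hij (h ▸ rfl)
  rw [eq_inl_of_right_eq_one hv1] at hvG
  rcases eq_or_ne k l with rfl | hkl
  · rw [← Pi.mulSingle_mul, sign_mul_self, Pi.mulSingle_one, map_one]
    exact G.one_mem
  rcases eq_or_ne s 1 with rfl | hs
  · simp
  obtain ⟨σ, hσk, hσl⟩ : ∃ σ : Perm (Fin n), σ k = i ∧ σ l = j := by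
    have h1 : swap k i l ≠ i := by
      intro h
      rw [Equiv.swap_apply_eq_iff, swap_apply_right] at h
      exact hkl h.symm
    refine ⟨swap (swap k i l) j * swap k i, ?_, ?_⟩
    · rw [Perm.mul_apply, swap_apply_left, swap_apply_of_ne_of_ne h1.symm hne]
    · rw [Perm.mul_apply, swap_apply_left]
  -- As `v` differs at `i` and `j`, its product with its transform under `swap i j` is nontrivial at
  -- exactly these two letters; conjugation moves them to `k` and `l`.
  have hprod : (SemidirectProduct.inl (fun m => v.left (swap i j m) * v.left m) :
      Hyperoctahedral n) ∈ G := by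
    have := G.mul_mem (hconj (swap i j) _ hvG) hvG
    rwa [← map_mul] at this
  have hmem := hconj σ _ hprod
  convert hmem using 2
  have hs' : ∀ t u : Multiplicative (ZMod 2), t ≠ u → s = t * u := by
    revert s; decide
  funext m
  rcases eq_or_ne m k with rfl | hmk
  · rw [Pi.mul_apply, Pi.mulSingle_eq_same, Pi.mulSingle_eq_of_ne hkl, mul_one, hσk,
      swap_apply_left]
    exact hs' _ _ hij.symm
  rcases eq_or_ne m l with rfl | hml
  · rw [Pi.mul_apply, Pi.mulSingle_eq_same, Pi.mulSingle_eq_of_ne hkl.symm, one_mul, hσl,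
      swap_apply_right]
    exact hs' _ _ hij
  rw [Pi.mul_apply, Pi.mulSingle_eq_of_ne hmk, Pi.mulSingle_eq_of_ne hml, swap_apply_of_ne_of_ne,
    mul_one, sign_mul_self]
  · exact hσk ▸ fun h => hmk (σ.injective h)
  · exact hσl ▸ fun h => hml (σ.injective h)

/-- A subgroup of `Bₙ` mapping onto `Σₙ` is everything if it contains a sign vector with two
distinct signs, and the signature and the product of signs are independent on it. -/
theorem eq_top_of_map_eq_top {G : Subgroup (Hyperoctahedral n)}
    (hG : G.map SemidirectProduct.rightHom = ⊤)
    (hv : ∃ v ∈ G, v.right = 1 ∧ ∃ i j, v.left i ≠ v.left j)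
    (hodd : ∃ g ∈ G, sign g.right = -1 ∧ prodSign n g = 1)
    (hprod : ∃ g ∈ G, prodSign n g ≠ 1) : G = ⊤ := by
  classical
  have hpair := inl_mulSingle_mul_mulSingle_mem hG hv
  -- the elements of `G` with trivial product of signs map onto `Σₙ`
  let D : Subgroup (Perm (Fin n)) := (G ⊓ (prodSign n).ker).map SemidirectProduct.rightHom
  have hA : alternatingGroup (Fin n) ≤ D := by
    rw [← Equiv.Perm.closure_three_cycles_eq_alternating, Subgroup.closure_le]
    intro c hc
    obtain ⟨g, hg, hgc⟩ := exists_mem_right_eq hG (c ^ 2)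
    -- Squares have trivial product of signs, and a three-cycle is the square of its own square.
    refine ⟨g ^ 2, ⟨G.pow_mem hg 2, ?_⟩, ?_⟩
    · change prodSign n (g ^ 2) = 1
      rw [map_pow, pow_two, sign_mul_self]
    · rw [map_pow]
      change g.right ^ 2 = c
      have h3 : c ^ 3 = 1 := by
        rw [← Equiv.Perm.IsThreeCycle.orderOf hc, pow_orderOf_eq_one]
      rw [hgc, ← pow_mul, show 2 * 2 = 3 + 1 from rfl, pow_succ, h3, one_mul]
  have hD : ∀ σ, σ ∈ D := by
    obtain ⟨g, hg, hgs, hgp⟩ := hodd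
    have hgD : g.right ∈ D := ⟨g, ⟨hg, hgp⟩, rfl⟩
    intro σ
    rcases Int.units_eq_one_or (sign σ) with h | h
    · exact hA h
    · have : σ * g.right ∈ D := hA (by rw [Equiv.Perm.mem_alternatingGroup, map_mul, h, hgs]; rfl)
      exact (D.mul_mem_cancel_right hgD).1 this
  -- Dividing an element with nontrivial product of signs by one with trivial product over the same
  -- permutation leaves a sign vector with nontrivial product.
  obtain ⟨b₀, hb₀, hb₀p⟩ : ∃ b : Fin n → Multiplicative (ZMod 2),
      (SemidirectProduct.inl b : Hyperoctahedral n) ∈ G ∧ ∏ i, b i ≠ 1 := by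
    obtain ⟨g, hg, hgp⟩ := hprod
    obtain ⟨h, ⟨hh, hhp⟩, hhr⟩ := hD g.right
    have h1 : (g * h⁻¹).right = 1 := by
      change g.right * h.right⁻¹ = 1
      rw [mul_inv_eq_one]
      exact hhr.symm
    refine ⟨(g * h⁻¹).left, ?_, ?_⟩
    · rw [← eq_inl_of_right_eq_one h1]
      exact G.mul_mem hg (G.inv_mem hh)
    · change prodSign n (g * h⁻¹) ≠ 1
      rw [map_mul, map_inv, show prodSign n h = 1 from hhp]
      simpa using hgp
  have heven : ∀ b : Fin n → Multiplicative (ZMod 2), ∏ i, b i = 1 →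
      (SemidirectProduct.inl b : Hyperoctahedral n) ∈ G := by
    intro b hb
    rcases isEmpty_or_nonempty (Fin n) with _ | ⟨⟨k₀⟩⟩
    · rw [Subsingleton.elim b 1, map_one]
      exact G.one_mem
    have : b = ∏ k, (Pi.mulSingle k (b k) * Pi.mulSingle k₀ (b k)) := by
      rw [Finset.prod_mul_distrib, Finset.univ_prod_mulSingle]
      have h1 : ∏ k, (Pi.mulSingle k₀ (b k) : Fin n → Multiplicative (ZMod 2)) = 1 := by
        rw [← Pi.mulSingle_one k₀, ← hb]
        exact (map_prod (MonoidHom.mulSingle (fun _ : Fin n => Multiplicative (ZMod 2)) k₀)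
          b Finset.univ).symm
      rw [h1, mul_one]
    change b ∈ G.comap SemidirectProduct.inl
    rw [this]
    exact Subgroup.prod_mem _ fun k _ => hpair k k₀ _
  have hall : ∀ b : Fin n → Multiplicative (ZMod 2),
      (SemidirectProduct.inl b : Hyperoctahedral n) ∈ G := by
    intro b
    by_cases hb : ∏ i, b i = 1
    · exact heven b hb
    · have := heven (b * b₀) (by
        rw [← sign_mul_ne_one hb hb₀p, ← Finset.prod_mul_distrib]; rfl)
      rw [map_mul] at this
      exact (G.mul_mem_cancel_right hb₀).1 this
  rw [eq_top_iff]
  intro g _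
  obtain ⟨h, hh, hr⟩ := exists_mem_right_eq hG g.right
  have h1 : (g * h⁻¹).right = 1 := by
    change g.right * h.right⁻¹ = 1
    rw [mul_inv_eq_one, hr]
  have := hall (g * h⁻¹).left
  rw [← eq_inl_of_right_eq_one h1] at this
  exact (G.mul_mem_cancel_right (G.inv_mem hh)).1 this

/-- For `n ≥ 5`, a subgroup of `Bₙ` mapping onto `Σₙ` contains a sign vector with two distinct signs
as soon as one of its elements fixes two letters with distinct signs. -/
theorem exists_left_ne_of_fixed {G : Subgroup (Hyperoctahedral n)}
    (hG : G.map SemidirectProduct.rightHom = ⊤) (hn : 5 ≤ n) {u : Hyperoctahedral n} (hu : u ∈ G)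
    {f f' : Fin n} (hf : u.right f = f) (hf' : u.right f' = f')
    (hff' : signAt u f ≠ signAt u f') :
    ∃ v ∈ G, v.right = 1 ∧ ∃ i j, v.left i ≠ v.left j := by
  by_contra! hconst
  have hne : f ≠ f' := fun h => hff' (h ▸ rfl)
  -- The commutator of elements over commuting permutations is a sign vector, constant by
  -- assumption; both sides are entries of it.
  have key : ∀ g ∈ G, ∀ h ∈ G, Commute g.right h.right → ∀ i j,
      signAt g (h.right i) * signAt h i * signAt h (g.right i) * signAt g i =
      signAt g (h.right j) * signAt h j * signAt h (g.right j) * signAt g j := by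
    intro g hg h hh hcomm
    set v := g * h * g⁻¹ * h⁻¹ with hv
    have hvG : v ∈ G := G.mul_mem (G.mul_mem (G.mul_mem hg hh) (G.inv_mem hg)) (G.inv_mem hh)
    have hv1 : v.right = 1 := by
      change g.right * h.right * g.right⁻¹ * h.right⁻¹ = 1
      rw [hcomm.eq, mul_inv_cancel_right, mul_inv_cancel]
    have hval : ∀ i, v.left (h.right (g.right i)) =
        signAt g (h.right i) * signAt h i * signAt h (g.right i) * signAt g i := by
      intro i
      have h1 : v * h * g = g * h := by rw [hv]; group
      have h2 := congrArg (fun w => signAt w i) h1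
      simp only [signAt_mul] at h2
      have h3 : signAt v (h.right (g.right i)) = v.left (h.right (g.right i)) := by
        rw [signAt, hv1]; rfl
      rw [h3] at h2
      rw [← h2]
      generalize v.left _ = a
      generalize signAt h _ = b
      generalize signAt g i = c
      revert a b c; decide
    intro i j
    rw [← hval, ← hval]
    exact hconst v hvG hv1 _ _
  obtain ⟨g, hg, hgσ⟩ := exists_mem_right_eq hG (swap f f')
  have hcomm : Commute g.right u.right := by
    rw [hgσ]
    change swap f f' * u.right = u.right * swap f f'
    rw [Equiv.swap_mul_eq_mul_swap, Perm.inv_eq_iff_eq.2 hf.symm, Perm.inv_eq_iff_eq.2 hf'.symm]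
  have avoid : ∀ s : Finset (Fin n), s.card < 5 → ∃ i, i ∉ s := by
    intro s hs
    obtain ⟨i, -, hi⟩ := Finset.exists_mem_notMem_of_card_lt_card (s := s) (t := Finset.univ)
      (by simpa using hs.trans_le hn)
    exact ⟨i, hi⟩
  obtain ⟨a, ha⟩ := avoid {f, f'} (Finset.card_le_two.trans_lt (by norm_num))
  simp only [Finset.mem_insert, Finset.mem_singleton, not_or] at ha
  have hga : g.right a = a := by rw [hgσ, swap_apply_of_ne_of_ne ha.1 ha.2]
  -- At `f` the commutator of `g` and `u` has the entry `signAt u f * signAt u f' ≠ 1`; its entry at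
  -- `a` must agree. So `g` fixes `a` and `u.right a` with distinct signs.
  have hac : signAt g (u.right a) ≠ signAt g a := by
    have h := key g hg u hu hcomm f a
    rw [hga, hf, hgσ, swap_apply_left] at h
    intro e
    rw [e] at h
    revert h hff'
    generalize signAt g f = t₁
    generalize signAt u f = t₂
    generalize signAt u f' = t₃
    generalize signAt g a = t₄
    generalize signAt u a = t₅
    revert t₁ t₂ t₃ t₄ t₅; decide
  set c := u.right a with hc
  have hgc : g.right c = c := by
    rw [hgσ, swap_apply_of_ne_of_ne]
    · exact fun e => ha.1 (u.right.injective (e.trans hf.symm))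
    · exact fun e => ha.2 (u.right.injective (e.trans hf'.symm))
  obtain ⟨h, hh, hhτ⟩ := exists_mem_right_eq hG (swap a c)
  -- A fifth letter, fixed by both `g` and `h`: there the commutator has entry `1`, whereas the
  -- entry from `a` is `signAt g c * signAt g a ≠ 1`. This is where `n ≥ 5` is needed.
  obtain ⟨e, he⟩ := avoid {f, f', a, c} (Finset.card_le_four.trans_lt (by norm_num))
  simp only [Finset.mem_insert, Finset.mem_singleton, not_or] at he
  obtain ⟨hef, hef', hea, hec⟩ := he
  have hge : g.right e = e := by rw [hgσ, swap_apply_of_ne_of_ne hef hef']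
  have hhe : h.right e = e := by rw [hhτ, swap_apply_of_ne_of_ne hea hec]
  have hcomm' : Commute g.right h.right := by
    rw [hhτ]
    change g.right * swap a c = swap a c * g.right
    rw [Equiv.mul_swap_eq_swap_mul, hga, hgc]
  have hk := key g hg h hh hcomm' a e
  rw [hge, hhe, hga, hhτ, swap_apply_left] at hk
  revert hk hac
  generalize signAt g a = t₁
  generalize signAt g c = t₂
  generalize signAt h a = t₃
  generalize signAt g e = t₄
  generalize signAt h e = t₅
  revert t₁ t₂ t₃ t₄ t₅; decide

end Hyperoctahedral

/-! ### Prime cycles as powers, the signature, and quotients of triangle groups. -/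

/-- If the orbit of `a` under `W` has prime length `p` and all other orbits have lengths prime to
`p`, some power of `W` is a `p`-cycle supported on the orbit of `a`. -/
theorem exists_pow_isCycle {α : Type*} [Fintype α] [DecidableEq α] {W : Perm α} {p : ℕ}
    (hp : p.Prime) {a : α} (hpa : (W ^ p) a = a) (ha : W a ≠ a)
    (hW : ∀ i, (∃ k, (W ^ k) a = i) ∨ ∃ l, ¬ p ∣ l ∧ (W ^ l) i = i) :
    ∃ N, (W ^ N).IsCycle ∧ orderOf (W ^ N) = p ∧ ∀ k, (W ^ N) ((W ^ k) a) ≠ (W ^ k) a := by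
  have hl : ∀ i, ∃ l, ¬ p ∣ l ∧ ((∃ k, (W ^ k) a = i) ∨ (W ^ l) i = i) := by
    intro i
    rcases hW i with h | ⟨l, hl, h⟩
    · exact ⟨1, hp.one_lt.ne' ∘ Nat.dvd_one.1, Or.inl h⟩
    · exact ⟨l, hl, Or.inr h⟩
  choose l hlp hl using hl
  -- The exponent is a common multiple of periods of all letters outside the orbit of `a`. Being
  -- prime to `p`, it does not kill the `p`-cycle.
  have hN : ¬ p ∣ ∏ i, l i := by
    rw [hp.prime.dvd_finsetProd_iff]
    rintro ⟨i, -, hi⟩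
    exact hlp i hi
  set N := ∏ i, l i
  have hfix : ∀ i, (∃ k, (W ^ k) a = i) ∨ (W ^ N) i = i := by
    intro i
    refine (hl i).imp_right fun h => ?_
    obtain ⟨d, hd⟩ : l i ∣ N := Finset.dvd_prod_of_mem l (Finset.mem_univ i)
    rw [hd, pow_mul]
    exact Perm.pow_apply_eq_self_of_apply_eq_self h d
  have hmove : ∀ k, (W ^ N) ((W ^ k) a) ≠ (W ^ k) a := by
    intro k h
    rw [← Perm.mul_apply, ← pow_add, add_comm, pow_add, Perm.mul_apply] at h
    have h1 : Function.IsPeriodicPt W N a := by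
      rw [Function.IsPeriodicPt, ← Perm.coe_pow]
      exact (W ^ k).injective h
    have h2 : Function.IsPeriodicPt W p a := by
      rw [Function.IsPeriodicPt, ← Perm.coe_pow]
      exact hpa
    have h3 := h1.gcd h2
    rw [Nat.gcd_comm, (hp.coprime_iff_not_dvd.2 hN : Nat.gcd p N = 1)] at h3
    exact ha h3
  have hpow : (W ^ N) ^ p = 1 := by
    ext i
    rcases hfix i with ⟨k, rfl⟩ | h
    · rw [← pow_mul, ← Perm.mul_apply, ← pow_add, add_comm, pow_add, Perm.mul_apply, mul_comm,
        pow_mul, Perm.pow_apply_eq_self_of_apply_eq_self hpa]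
      rfl
    · rw [Perm.pow_apply_eq_self_of_apply_eq_self h]
      rfl
  have hone : W ^ N ≠ 1 := fun h => hmove 0 (by rw [h]; rfl)
  have hord : orderOf (W ^ N) = p := by
    have := Fact.mk hp
    exact orderOf_eq_prime hpow hone
  refine ⟨N, ?_, hord, hmove⟩
  -- An element of prime order `p` moving fewer than `2 * p` points is a single cycle.
  refine isCycle_of_prime_order (hord.symm ▸ hp) ?_
  have hsub : (W ^ N).support ⊆ (Finset.range p).image fun k => (W ^ k) a := by
    intro i hi
    rcases hfix i with ⟨k, rfl⟩ | h
    · refine Finset.mem_image.2 ⟨k % p, Finset.mem_range.2 (Nat.mod_lt _ hp.pos), ?_⟩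
      conv_rhs => rw [← Nat.mod_add_div k p, pow_add, Perm.mul_apply, pow_mul,
        Perm.pow_apply_eq_self_of_apply_eq_self hpa]
    · exact absurd h (Perm.mem_support.1 hi)
  have := (Finset.card_le_card hsub).trans Finset.card_image_le
  rw [Finset.card_range] at this
  have := hp.pos
  omega

/-- The signature as a product over inversions, read off from the images as natural numbers. -/
theorem sign_eq_prod_range {n : ℕ} (σ : Perm (Fin n)) {f : ℕ → ℕ} (hf : ∀ i : Fin n, f i = σ i) :
    sign σ = ∏ j ∈ Finset.range n, ∏ i ∈ Finset.range j, if f j < f i then (-1 : ℤˣ) else 1 := by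
  rw [Equiv.Perm.sign_eq_prod_prod_Iio, Finset.prod_range]
  refine Finset.prod_congr rfl fun j _ => ?_
  refine Finset.prod_bij' (i := fun i _ => i.val) (j := fun i hi => ⟨i, by
    exact (Finset.mem_range.1 hi).trans j.2⟩) ?_ ?_ ?_ ?_ ?_
  · intro i hi
    simpa using hi
  · intro i hi
    simpa [Fin.lt_def] using hi
  · intros; rfl
  · intros; rfl
  · intro i hi
    rw [hf, hf]
    have hij : σ i ≠ σ j := fun h => (Finset.mem_Iio.1 hi).ne (σ.injective h)
    have hij' : (σ i : ℕ) ≠ σ j := fun h => hij (Fin.ext h)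
    simp only [Fin.lt_def]
    split_ifs <;> first | rfl | omega

/-- Generators satisfying the relations of a triangle group make the group a quotient of it. -/
theorem isQuotientOf_of_closure_eq_top {G : Type*} [Group G] {p q r : ℕ} {X Y : G}
    (hX : X ^ p = 1) (hY : Y ^ q = 1) (hXY : (X * Y) ^ r = 1)
    (h : Subgroup.closure {X, Y} = ⊤) : IsQuotientOf G (TriangleGroup p q r) := by
  let F : TriangleGen → G
    | .x => X
    | .y => Y
    | .z => (X * Y)⁻¹
  have hF : ∀ s ∈ triangleRels p q r, FreeGroup.lift F s = 1 := by
    rintro s (rfl | rfl | rfl | rfl)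
    · simpa [F] using hX
    · simpa [F] using hY
    · simp only [F, map_pow, FreeGroup.lift_apply_of, inv_pow, hXY, inv_one]
    · simp [F]
  refine ⟨PresentedGroup.toGroup hF, ?_⟩
  rw [← MonoidHom.range_eq_top, eq_top_iff, ← h, Subgroup.closure_le]
  rintro g (rfl | rfl)
  · exact ⟨PresentedGroup.of TriangleGen.x, PresentedGroup.toGroup.of hF⟩
  · exact ⟨PresentedGroup.of TriangleGen.y, PresentedGroup.toGroup.of hF⟩

/-! ### Signed permutations as tables, words, and the generation criterion. -/

namespace Hyperoctahedral

/-- A letter together with a sign, moved by a table of signed images. -/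
def step (T : ℕ → ℕ × Bool) (q : ℕ × Bool) : ℕ × Bool :=
  ((T q.1).1, xor q.2 (T q.1).2)

/-- The effect of a word in two signed maps, read from left to right; the letter `false` stands for
the first map and `true` for the second one. -/
def run (x y : ℕ → ℕ × Bool) : List Bool → ℕ × Bool → ℕ × Bool
  | [], q => q
  | b :: w, q => run x y w (step (cond b y x) q)

/-- The power of a word. -/
def wordPow (w : List Bool) (k : ℕ) : List Bool :=
  (List.replicate k w).flatten

def boolSign (b : Bool) : Multiplicative (ZMod 2) :=
  cond b (Multiplicative.ofAdd 1) 1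

theorem boolSign_xor (a b : Bool) : boolSign (xor a b) = boolSign a * boolSign b := by
  revert a b; decide

theorem boolSign_injective : Function.Injective boolSign := by
  unfold Function.Injective; decide

variable {n : ℕ}

/-- The signed permutation `g` has the table of signed images `T`. -/
def Represents (g : Hyperoctahedral n) (T : ℕ → ℕ × Bool) : Prop :=
  ∀ i : Fin n, (T i).1 = g.right i ∧ boolSign (T i).2 = signAt g i

theorem exists_represents {T : ℕ → ℕ × Bool} {L : ℕ → ℕ} (hT : ∀ i < n, (T i).1 < n)
    (hL : ∀ i < n, L (T i).1 = i) : ∃ g : Hyperoctahedral n, Represents g T := by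
  let f : Fin n → Fin n := fun i => ⟨(T i).1, hT i i.2⟩
  have hf : Function.Injective f := fun i j h => by
    have h1 : (T i).1 = (T j).1 := congrArg Fin.val h
    exact Fin.ext (by rw [← hL i i.2, ← hL j j.2, h1])
  let σ : Perm (Fin n) := Equiv.ofBijective f (Finite.injective_iff_bijective.1 hf)
  refine ⟨⟨fun i => boolSign (T (σ.symm i)).2, σ⟩, fun i => ⟨rfl, ?_⟩⟩
  change _ = boolSign (T (σ.symm (σ i))).2
  rw [Equiv.symm_apply_apply]

/-- The group element given by a word. -/
def wordElt (X Y : Hyperoctahedral n) : List Bool → Hyperoctahedral n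
  | [] => 1
  | b :: w => wordElt X Y w * cond b Y X

/-- The order is reversed because words are read from left to right while permutations compose from
right to left. -/
theorem wordElt_append (X Y : Hyperoctahedral n) (v w : List Bool) :
    wordElt X Y (v ++ w) = wordElt X Y w * wordElt X Y v := by
  induction v with
  | nil => simp [wordElt]
  | cons b v ih => simp [wordElt, ih, mul_assoc]

theorem wordElt_wordPow (X Y : Hyperoctahedral n) (w : List Bool) (k : ℕ) :
    wordElt X Y (wordPow w k) = wordElt X Y w ^ k := by
  induction k with
  | zero => rfl
  | succ k ih =>
    rw [pow_succ, ← ih, ← wordElt_append]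
    rfl

theorem wordElt_mem (X Y : Hyperoctahedral n) (w : List Bool) :
    wordElt X Y w ∈ Subgroup.closure {X, Y} := by
  induction w with
  | nil => exact Subgroup.one_mem _
  | cons b w ih =>
    refine Subgroup.mul_mem _ ih (Subgroup.subset_closure ?_)
    cases b <;> simp

section Run

variable {X Y : Hyperoctahedral n} {x y : ℕ → ℕ × Bool}

theorem run_eq (hX : Represents X x) (hY : Represents Y y) (w : List Bool) (i : Fin n) (s : Bool) :
    (run x y w (i, s)).1 = (wordElt X Y w).right i ∧
      boolSign (run x y w (i, s)).2 = boolSign s * signAt (wordElt X Y w) i := by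
  induction w generalizing i s with
  | nil => simp [run, wordElt, signAt_one]
  | cons b w ih =>
    have hstep : ∃ t, step (cond b y x) (i, s) = (((cond b Y X).right i : Fin n).val, t) ∧
        boolSign t = boolSign s * signAt (cond b Y X) i := by
      refine ⟨_, Prod.ext ?_ rfl, ?_⟩
      · cases b
        · exact (hX i).1
        · exact (hY i).1
      · cases b
        · simp only [step, cond_false, boolSign_xor, (hX i).2]
        · simp only [step, cond_true, boolSign_xor, (hY i).2]
    obtain ⟨t, ht, hts⟩ := hstep
    rw [run, ht, wordElt]
    refine ⟨(ih _ t).1, ?_⟩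
    rw [(ih _ t).2, hts, signAt_mul, mul_assoc, mul_comm (signAt (cond b Y X) i)]

theorem wordElt_eq_one (hX : Represents X x) (hY : Represents Y y) {w : List Bool}
    (h : ∀ i < n, run x y w (i, false) = (i, false)) : wordElt X Y w = 1 := by
  refine ext_signAt (fun i => Fin.ext ?_) fun i => ?_
  · rw [← (run_eq hX hY w i false).1, h i i.2]
    rfl
  · have := (run_eq hX hY w i false).2
    rw [h i i.2] at this
    rw [signAt_one]
    simpa [boolSign] using this.symm

theorem wordElt_ne_one (hX : Represents X x) (hY : Represents Y y) {w : List Bool} {i : ℕ}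
    (hi : i < n) (h : run x y w (i, false) ≠ (i, false)) : wordElt X Y w ≠ 1 := by
  intro h1
  refine h (Prod.ext ?_ (boolSign_injective ?_))
  · rw [(run_eq hX hY w ⟨i, hi⟩ false).1, h1]
    rfl
  · rw [(run_eq hX hY w ⟨i, hi⟩ false).2, h1, signAt_one, mul_one]

/-- A criterion for two signed permutations to generate `Bₙ`, in terms of their tables `x`, `y`:
the group is transitive, the word `w` has a single orbit `S` of length divisible by the prime `p`,
this orbit has length `p` and meets its images under both generators, some word fixes two letters
with distinct signs, and the signature and the product of signs are independent. -/
theorem closure_eq_top_of_run (hX : Represents X x) (hY : Represents Y y)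
    (htrans : ∀ i < n, i ≠ 0 → ∃ v, (run x y v (i, false)).1 < i)
    {p : ℕ} (hp : p.Prime) (hpn : 2 * p ≤ n + 1) (hlt : p < n)
    {w : List Bool} {a : ℕ} (ha : a < n) (hwa : (run x y w (a, false)).1 ≠ a)
    (hwpa : (run x y (wordPow w p) (a, false)).1 = a) {S : List ℕ}
    (hS : ∀ i ∈ S, ∃ k, (run x y (wordPow w k) (a, false)).1 = i)
    (hw : ∀ i < n, i ∈ S ∨ ∃ l, ¬ p ∣ l ∧ (run x y (wordPow w l) (i, false)).1 = i)
    (hxS : ∃ i < n, i ∈ S ∧ (x i).1 ∈ S) (hyS : ∃ i < n, i ∈ S ∧ (y i).1 ∈ S)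
    {u : List Bool} {f f' : ℕ} {s : Bool} (hf : f < n) (hf' : f' < n)
    (huf : run x y u (f, false) = (f, s)) (huf' : run x y u (f', false) = (f', !s))
    (hu : 5 ≤ n ∨ ∀ i < n, (run x y u (i, false)).1 = i)
    (hysign : (∏ j ∈ Finset.range n, ∏ i ∈ Finset.range j,
      if (y j).1 < (y i).1 then (-1 : ℤˣ) else 1) = -1)
    (hyprod : ∏ i ∈ Finset.range n, boolSign (y i).2 = 1)
    (hxprod : ∏ i ∈ Finset.range n, boolSign (x i).2 ≠ 1) :
    Subgroup.closure {X, Y} = ⊤ := by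
  set G := Subgroup.closure {X, Y} with hGdef
  have hmap : G.map SemidirectProduct.rightHom = Subgroup.closure {X.right, Y.right} := by
    rw [hGdef, MonoidHom.map_closure, Set.image_pair]
    rfl
  have hrun : ∀ v (i : Fin n), (run x y v (i, false)).1 = (wordElt X Y v).right i :=
    fun v i => (run_eq hX hY v i false).1
  have hmemr : ∀ v, (wordElt X Y v).right ∈ Subgroup.closure {X.right, Y.right} := fun v =>
    hmap ▸ ⟨_, wordElt_mem X Y v, rfl⟩
  have hpow : ∀ v k, (wordElt X Y (wordPow v k)).right = (wordElt X Y v).right ^ k := fun v k => by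
    rw [wordElt_wordPow]
    exact map_pow SemidirectProduct.rightHom _ k
  have hpos : 0 < n := by omega
  -- Descent: every letter other than `0` can be moved to a smaller one.
  have htr : IsPretransitive (Subgroup.closure {X.right, Y.right}) (Fin n) := by
    refine (MulAction.isPretransitive_iff_base (⟨0, hpos⟩ : Fin n)).2 ?_
    suffices H : ∀ m (hm : m < n), ∃ g : Subgroup.closure {X.right, Y.right},
        g • (⟨0, hpos⟩ : Fin n) = ⟨m, hm⟩ from fun i => H i i.2
    intro m
    induction m using Nat.strong_induction_on with
    | _ m ih =>
      intro hm
      rcases eq_or_ne m 0 with rfl | hm0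
      · exact ⟨1, one_smul _ _⟩
      obtain ⟨v, hv⟩ := htrans m hm hm0
      have hv' := hrun v ⟨m, hm⟩
      obtain ⟨g, hg⟩ := ih _ (hv' ▸ hv) (Fin.is_lt _)
      refine ⟨⟨_, hmemr v⟩⁻¹ * g, ?_⟩
      rw [mul_smul, hg, inv_smul_eq_iff]
      rfl
  set W := (wordElt X Y w).right with hW
  have hWk : ∀ k (i : Fin n), (run x y (wordPow w k) (i, false)).1 = (W ^ k) i := fun k i => by
    rw [hrun, hpow]
  obtain ⟨N, hcyc, hord, hmove⟩ := exists_pow_isCycle (W := W) (a := ⟨a, ha⟩) hp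
    (Fin.ext (by rw [← hWk, hwpa])) (fun h => hwa (by rw [hrun w ⟨a, ha⟩, ← hW, h])) (by
      intro i
      rcases hw i i.2 with h | ⟨l, hl, h⟩
      · obtain ⟨k, hk⟩ := hS i h
        exact Or.inl ⟨k, Fin.ext (by rw [← hWk, hk])⟩
      · exact Or.inr ⟨l, hl, Fin.ext (by rw [← hWk, h])⟩)
  have hSmove : ∀ i : Fin n, (i : ℕ) ∈ S → (W ^ N) i ≠ i := by
    intro i hi
    obtain ⟨k, hk⟩ := hS i hi
    have : (W ^ k) ⟨a, ha⟩ = i := Fin.ext (by rw [← hWk, hk])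
    exact this ▸ hmove k
  have hcmem : W ^ N ∈ Subgroup.closure {X.right, Y.right} := Subgroup.pow_mem _ (hmemr w) N
  have hprim : IsPreprimitive (Subgroup.closure {X.right, Y.right}) (Fin n) := by
    refine isPreprimitive_of_isCycle hcmem hcyc (hord ▸ hp) ?_ ?_
    · obtain ⟨i, hi, hiS, hxi⟩ := hxS
      exact ⟨⟨i, hi⟩, hSmove _ hiS, hSmove _ ((hX ⟨i, hi⟩).1 ▸ hxi)⟩
    · obtain ⟨i, hi, hiS, hyi⟩ := hyS
      exact ⟨⟨i, hi⟩, hSmove _ hiS, hSmove _ ((hY ⟨i, hi⟩).1 ▸ hyi)⟩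
  have hA := alternatingGroup_le_of_isCycle_of_prime hprim hcmem hcyc hp
    (by rw [← hcyc.orderOf, hord]) (by simpa using hpn) (by simpa using hlt)
  have hsignY : sign Y.right = -1 := by
    rw [← hysign]
    exact sign_eq_prod_range Y.right fun i => (hY i).1
  have hYmem : Y.right ∈ Subgroup.closure {X.right, Y.right} := Subgroup.subset_closure (by simp)
  -- The image contains the alternating group and the odd permutation `Y.right`.
  have htop : G.map SemidirectProduct.rightHom = ⊤ := by
    rw [hmap, eq_top_iff]
    intro σ _
    rcases Int.units_eq_one_or (sign σ) with h | h
    · exact hA h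
    · have : σ * Y.right ∈ Subgroup.closure {X.right, Y.right} :=
        hA (by rw [Equiv.Perm.mem_alternatingGroup, map_mul, h, hsignY]; rfl)
      exact (Subgroup.mul_mem_cancel_right _ hYmem).1 this
  have hprodSign : ∀ {g : Hyperoctahedral n} {T : ℕ → ℕ × Bool}, Represents g T →
      prodSign n g = ∏ i ∈ Finset.range n, boolSign (T i).2 := by
    intro g T hg
    rw [prodSign_apply, Finset.prod_range]
    exact Finset.prod_congr rfl fun i _ => (hg i).2.symm
  have hsigns : ∀ i (hi : i < n), boolSign (run x y u (i, false)).2 =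
      signAt (wordElt X Y u) ⟨i, hi⟩ := fun i hi => by
    rw [(run_eq hX hY u ⟨i, hi⟩ false).2]
    exact one_mul _
  have hfix : ∀ i (hi : i < n), (run x y u (i, false)).1 = i →
      (wordElt X Y u).right ⟨i, hi⟩ = ⟨i, hi⟩ := fun i hi h => Fin.ext (by
    rw [← hrun, h])
  have hne : signAt (wordElt X Y u) ⟨f, hf⟩ ≠ signAt (wordElt X Y u) ⟨f', hf'⟩ := by
    rw [← hsigns, ← hsigns, huf, huf']
    change boolSign s ≠ boolSign !s
    exact fun h => by simpa using boolSign_injective h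
  refine eq_top_of_map_eq_top htop ?_ ⟨Y, Subgroup.subset_closure (by simp), hsignY, ?_⟩
    ⟨X, Subgroup.subset_closure (by simp), ?_⟩
  · rcases hu with hn | hu
    · exact exists_left_ne_of_fixed htop hn (wordElt_mem X Y u)
        (hfix f hf (by rw [huf])) (hfix f' hf' (by rw [huf'])) hne
    · have h1 : (wordElt X Y u).right = 1 := Equiv.ext fun i => hfix i i.2 (hu i i.2)
      refine ⟨_, wordElt_mem X Y u, h1, ⟨f, hf⟩, ⟨f', hf'⟩, ?_⟩
      simpa only [signAt, h1, Perm.one_apply] using hne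
  · rw [hprodSign hY, hyprod]
  · rw [hprodSign hX]
    exact hxprod

end Run

/-! ### Certificates and their local verification. -/

/-- `run`, restricted to trajectories in which the generators are applied to letters in `[lo, hi)`
only. -/
def runIn (lo hi : ℕ) (x y : ℕ → ℕ × Bool) : List Bool → ℕ × Bool → Option (ℕ × Bool)
  | [], q => some q
  | b :: w, q =>
    if lo ≤ q.1 ∧ q.1 < hi then runIn lo hi x y w (step (cond b y x) q) else none

/-- On `[lo, hi)`, the signed map `T'` is the translate of `T` by `s`. -/
def IsTranslate (T T' : ℕ → ℕ × Bool) (s lo hi : ℕ) : Prop :=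
  ∀ q, lo ≤ q → q < hi → T' (q + s) = ((T q).1 + s, (T q).2)

/-- A trajectory that consults the tables inside a window only is carried along when the window is
translated. This transfers computations from short chains to long ones. -/
theorem run_of_runIn {x y x' y' : ℕ → ℕ × Bool} {s lo hi : ℕ} (hx : IsTranslate x x' s lo hi)
    (hy : IsTranslate y y' s lo hi) {w : List Bool} {q r : ℕ × Bool}
    (h : runIn lo hi x y w q = some r) : run x' y' w (q.1 + s, q.2) = (r.1 + s, r.2) := by
  induction w generalizing q with
  | nil =>
    rw [runIn, Option.some.injEq] at h
    rw [run, h]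
  | cons b w ih =>
    rw [runIn] at h
    split_ifs at h with hq
    rw [run, ← ih h]
    congr 1
    cases b
    · simp only [step, cond_false, hx _ hq.1 hq.2]
    · simp only [step, cond_true, hy _ hq.1 hq.2]

theorem run_fst_eq (x y : ℕ → ℕ × Bool) (w : List Bool) (i : ℕ) (s s' : Bool) :
    (run x y w (i, s)).1 = (run x y w (i, s')).1 := by
  induction w generalizing i s s' with
  | nil => rfl
  | cons b w ih => exact ih _ _ _

/-- The letters in the orbit of `a` under the word `w`, if this orbit has length at most `p`. -/
def orbitList (x y : ℕ → ℕ × Bool) (w : List Bool) (p a : ℕ) : List ℕ :=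
  (List.range p).map fun k => (run x y (wordPow w k) (a, false)).1

/-- The signature of a map, as a product over inversions. -/
def invProd (f : ℕ → ℕ) (n : ℕ) : ℤˣ :=
  ∏ j ∈ Finset.range n, ∏ i ∈ Finset.range j, if f j < f i then -1 else 1

/-- The words and letters by which one verifies that two signed permutations generate `Bₙ` and
satisfy the relations `x ^ e₁ = y ^ e₂ = (x y) ^ r = 1`: the orbit of `a` under `cycle` is the only
one whose length is divisible by `p`, the other orbits have their lengths among `lengths`, the
words in `moving` do not fix the signed letter `moved`, and `signed` fixes the letters `f₁`, `f₂`
with the signs `s` and `!s`. -/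
structure Certificate where
  e₁ : ℕ
  e₂ : ℕ
  r : ℕ
  p : ℕ
  cycle : List Bool
  a : ℕ
  lengths : List ℕ
  moving : List (List Bool)
  moved : ℕ
  signed : List Bool
  s : Bool
  f₁ : ℕ
  f₂ : ℕ

namespace Certificate

/-- The local conditions at the letter `q`, verified within the window `[lo, hi)`. -/
def letterCheck (C : Certificate) (x y : ℕ → ℕ × Bool) (n : ℕ) (S : List ℕ) (lo hi q : ℕ) : Bool :=
  (runIn lo hi x y [false] (q, false)).any (fun t => decide (t.1 < n)) &&
  (runIn lo hi x y [true] (q, false)).any (fun t => decide (t.1 < n)) &&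
  decide (runIn lo hi x y (wordPow [false] C.e₁) (q, false) = some (q, false)) &&
  decide (runIn lo hi x y (wordPow [true] C.e₂) (q, false) = some (q, false)) &&
  decide (runIn lo hi x y (wordPow [true, false] C.r) (q, false) = some (q, false)) &&
  (decide (q = 0) || [[false], [true], wordPow [false] (C.e₁ - 1), wordPow [true] (C.e₂ - 1)].any
    fun v => (runIn lo hi x y v (q, false)).any fun t => decide (t.1 < q)) &&
  (decide (q ∈ S) || C.lengths.any fun l => decide (¬ C.p ∣ l) &&
    (runIn lo hi x y (wordPow C.cycle l) (q, false)).any fun t => decide (t.1 = q))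

/-- The conditions on single letters, verified in the windows `[0, hi)` and `[lo, n)`. -/
def globalCheck (C : Certificate) (x y : ℕ → ℕ × Bool) (n : ℕ) (S : List ℕ) (hi lo : ℕ) : Bool :=
  decide (C.a < n) && decide (C.moved < n) && decide (C.f₁ < n) && decide (C.f₂ < n) &&
  decide (2 * C.p ≤ n + 1) && decide (C.p < n) && decide (hi ≤ n) &&
  decide (0 < C.e₁) && decide (0 < C.e₂) &&
  (runIn 0 hi x y C.cycle (C.a, false)).any (fun t => decide (t.1 ≠ C.a)) &&
  (runIn 0 hi x y (wordPow C.cycle C.p) (C.a, false)).any (fun t => decide (t.1 = C.a)) &&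
  (S.all fun i => (List.range C.p).any fun k =>
    (runIn 0 hi x y (wordPow C.cycle k) (C.a, false)).any fun t => decide (t.1 = i)) &&
  (S.any fun i => decide (i < hi ∧ (x i).1 ∈ S)) &&
  (S.any fun i => decide (i < hi ∧ (y i).1 ∈ S)) &&
  (C.moving.all fun v => (runIn 0 hi x y v (C.moved, false)).any
    fun t => decide (t ≠ (C.moved, false))) &&
  decide (runIn 0 hi x y C.signed (C.f₁, false) = some (C.f₁, C.s)) &&
  decide (runIn lo n x y C.signed (C.f₂, false) = some (C.f₂, !C.s))

/-- The signed word fixes all letters; only needed for `n < 5`. -/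
def pureCheck (C : Certificate) (x y : ℕ → ℕ × Bool) (n : ℕ) : Bool :=
  decide (5 ≤ n) || (List.range n).all fun i => decide ((run x y C.signed (i, false)).1 = i)

/-- The certificate is valid for the tables `x` and `y`, which are inspected near the letter `q`
within the window `win q` only; letters from `b` on are not in the distinguished orbit. -/
def check (C : Certificate) (x y : ℕ → ℕ × Bool) (n b hi lo : ℕ) (win : ℕ → ℕ × ℕ) : Bool :=
  let S := orbitList x y C.cycle C.p C.a
  ((List.range n).all fun q =>
    C.letterCheck x y n (if q < b then S else []) (win q).1 (win q).2 q) &&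
  C.globalCheck x y n S hi lo

/-- The certificate is computed for `x`, `y` but used for `x'`, `y'`: by `hlocal` each letter of the
latter looks like a translate of a letter of the former. Properly shifted letters must come from
outside the distinguished orbit (`b ≤ q`), and from `q ≠ 0`, since `0` is exempt from the descent
condition. -/
theorem exists_generators (C : Certificate) (hp : C.p.Prime) {x y : ℕ → ℕ × Bool}
    {n b hi lo : ℕ} {win : ℕ → ℕ × ℕ} (hC : C.check x y n b hi lo win = true)
    {x' y' : ℕ → ℕ × Bool} {n' t : ℕ} (hn' : n' = n + t)
    (hpure : 5 ≤ n' ∨ ∀ i < n', (run x' y' C.signed (i, false)).1 = i)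
    (hlocal : ∀ i < n', ∃ q s, i = q + s ∧ q < n ∧ s ≤ t ∧ (s = 0 ∨ b ≤ q ∧ q ≠ 0) ∧
      IsTranslate x x' s (win q).1 (win q).2 ∧ IsTranslate y y' s (win q).1 (win q).2)
    (hhead : IsTranslate x x' 0 0 hi ∧ IsTranslate y y' 0 0 hi)
    (htail : IsTranslate x x' t lo n ∧ IsTranslate y y' t lo n)
    (hysign : invProd (fun i => (y' i).1) n' = -1)
    (hyprod : ∏ i ∈ Finset.range n', boolSign (y' i).2 = 1)
    (hxprod : ∏ i ∈ Finset.range n', boolSign (x' i).2 ≠ 1) :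
    ∃ X Y : Hyperoctahedral n', Subgroup.closure {X, Y} = ⊤ ∧ X ^ C.e₁ = 1 ∧ Y ^ C.e₂ = 1 ∧
      (X * Y) ^ C.r = 1 ∧ X ≠ 1 ∧ ∀ v ∈ C.moving, wordElt X Y v ≠ 1 := by
  obtain ⟨hletters, hglobal⟩ := Bool.and_eq_true_iff.1 hC
  set S := orbitList x y C.cycle C.p C.a
  simp only [globalCheck, Bool.and_eq_true, decide_eq_true_eq, List.all_eq_true, List.any_eq_true,
    Option.any_eq_true] at hglobal
  obtain ⟨⟨⟨⟨⟨⟨⟨⟨⟨⟨⟨⟨⟨⟨⟨⟨han, hon⟩, hf₁⟩, hf₂⟩, hpn⟩, hlt⟩, hhin⟩, he₁⟩, he₂⟩, hwa⟩, hwpa⟩, hS⟩,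
    hxS⟩, hyS⟩, hmoving⟩, hs₁⟩, hs₂⟩ := hglobal
  have hrun0 : ∀ {v i t}, runIn 0 hi x y v (i, false) = some t → run x' y' v (i, false) = t :=
    fun h => run_of_runIn hhead.1 hhead.2 h
  have hletter : ∀ i < n', ∃ q s, i = q + s ∧ s ≤ t ∧ (s = 0 ∨ q ≠ 0) ∧ (q ∈ S → s ≠ 0 → ¬ q < b) ∧
      ∃ lo hi, C.letterCheck x y n (if q < b then S else []) lo hi q = true ∧
      ∀ v z, runIn lo hi x y v (q, false) = some z → run x' y' v (i, false) = (z.1 + s, z.2) := by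
    intro i hi
    obtain ⟨q, s, rfl, hq, hs, hsb, htx, hty⟩ := hlocal i hi
    refine ⟨q, s, rfl, hs, hsb.imp_right And.right, fun _ h0 => ?_, _, _,
      List.all_eq_true.1 hletters q (List.mem_range.2 hq), fun v z h => run_of_runIn htx hty h⟩
    rcases hsb with h | h
    · exact absurd h h0
    · exact h.1.not_gt
  have hlet : ∀ i < n', (x' i).1 < n' ∧ (y' i).1 < n' ∧
      run x' y' (wordPow [false] C.e₁) (i, false) = (i, false) ∧
      run x' y' (wordPow [true] C.e₂) (i, false) = (i, false) ∧
      run x' y' (wordPow [true, false] C.r) (i, false) = (i, false) ∧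
      (i ≠ 0 → ∃ v, (run x' y' v (i, false)).1 < i) ∧
      (i ∈ S ∨ ∃ l, ¬ C.p ∣ l ∧ (run x' y' (wordPow C.cycle l) (i, false)).1 = i) := by
    intro i hi
    obtain ⟨q, s, rfl, hst, hsq, hqS, lo, hi', hcheck, hrun⟩ := hletter i hi
    simp only [letterCheck, Bool.and_eq_true, decide_eq_true_eq, List.any_eq_true,
      Option.any_eq_true, Bool.or_eq_true] at hcheck
    obtain ⟨⟨⟨⟨⟨⟨⟨zx, hzx, hzxn⟩, ⟨zy, hzy, hzyn⟩⟩, hxx⟩, hyy⟩, hzz⟩, hlow⟩, horb⟩ := hcheck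
    refine ⟨?_, ?_, hrun _ _ hxx, hrun _ _ hyy, hrun _ _ hzz, fun hne => ?_, ?_⟩
    · have : (x' (q + s)).1 = zx.1 + s := congrArg Prod.fst (hrun _ _ hzx)
      omega
    · have : (y' (q + s)).1 = zy.1 + s := congrArg Prod.fst (hrun _ _ hzy)
      omega
    · rcases hlow with h | ⟨v, -, z, hz, hzq⟩
      · omega
      · refine ⟨v, ?_⟩
        rw [hrun _ _ hz]
        exact Nat.add_lt_add_right hzq s
    · rcases horb with h | ⟨l, -, hl, z, hz, hzq⟩
      · left
        -- Membership in `S` is not translation invariant, but it is accepted only for `q < b`,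
        -- where the shift is `0`.
        split_ifs at h with hqb
        · by_cases hs0 : s = 0
          · rwa [hs0, add_zero]
          · exact absurd hqb (hqS h hs0)
        · simp at h
      · refine Or.inr ⟨l, hl, ?_⟩
        rw [hrun _ _ hz, hzq]
  -- The relation of exponent `e` makes the power `e - 1` an inverse table, so that the tables
  -- define permutations.
  have hinv : ∀ {b : Bool} {e : ℕ}, 0 < e →
      (∀ i < n', run x' y' (wordPow [b] e) (i, false) = (i, false)) → ∀ i < n',
      (run x' y' (wordPow [b] (e - 1)) ((cond b y' x' i).1, false)).1 = i := by
    intro b e he h i hi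
    obtain ⟨e, rfl⟩ := Nat.exists_eq_succ_of_ne_zero he.ne'
    have h1 := congrArg Prod.fst (h i hi)
    change (run x' y' (wordPow [b] e) (step (cond b y' x') (i, false))).1 = i at h1
    exact (run_fst_eq _ _ _ _ _ _).trans h1
  obtain ⟨X, hX⟩ := exists_represents
    (L := fun p => (run x' y' (wordPow [false] (C.e₁ - 1)) (p, false)).1)
    (fun i hi => (hlet i hi).1) (hinv (b := false) he₁ fun i hi => (hlet i hi).2.2.1)
  obtain ⟨Y, hY⟩ := exists_represents
    (L := fun p => (run x' y' (wordPow [true] (C.e₂ - 1)) (p, false)).1)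
    (fun i hi => (hlet i hi).2.1) (hinv (b := true) he₂ fun i hi => (hlet i hi).2.2.2.1)
  have hXrel := wordElt_eq_one hX hY fun i hi => (hlet i hi).2.2.1
  have hYrel := wordElt_eq_one hX hY fun i hi => (hlet i hi).2.2.2.1
  have hXYrel := wordElt_eq_one hX hY fun i hi => (hlet i hi).2.2.2.2.1
  rw [wordElt_wordPow] at hXrel hYrel hXYrel
  simp only [wordElt, cond_true, cond_false, one_mul] at hXrel hYrel hXYrel
  have hnn : n ≤ n' := by omega
  have hXne : X ≠ 1 := by
    rintro rfl
    apply hxprod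
    refine Finset.prod_eq_one fun i hi => ?_
    rw [(hX ⟨i, Finset.mem_range.1 hi⟩).2, signAt_one]
  refine ⟨X, Y, ?_, hXrel, hYrel, hXYrel, hXne, ?_⟩
  · obtain ⟨z₁, hz₁, hz₁a⟩ := hwa
    obtain ⟨z₂, hz₂, hz₂a⟩ := hwpa
    refine closure_eq_top_of_run hX hY (fun i hi => (hlet i hi).2.2.2.2.2.1) hp (by omega)
      (by omega) (w := C.cycle) (a := C.a) (by omega) (by rwa [hrun0 hz₁])
      (by rwa [hrun0 hz₂]) (S := S) ?_ (fun i hi => (hlet i hi).2.2.2.2.2.2) ?_ ?_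
      (u := C.signed) (f := C.f₁) (f' := C.f₂ + t) (s := C.s) (by omega) (by omega) (hrun0 hs₁)
      (run_of_runIn htail.1 htail.2 hs₂) hpure hysign hyprod hxprod
    · intro i hi
      obtain ⟨k, -, z, hz, hzi⟩ := hS i hi
      exact ⟨k, by rw [hrun0 hz, hzi]⟩
    · obtain ⟨i, hi, hin, hix⟩ := hxS
      have := hhead.1 i (Nat.zero_le _) hin
      simp only [add_zero] at this
      exact ⟨i, by omega, hi, by rwa [this]⟩
    · obtain ⟨i, hi, hin, hix⟩ := hyS
      have := hhead.2 i (Nat.zero_le _) hin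
      simp only [add_zero] at this
      exact ⟨i, by omega, hi, by rwa [this]⟩
  · intro v hv
    obtain ⟨z, hz, hzne⟩ := hmoving v hv
    exact wordElt_ne_one hX hY (by omega : C.moved < n') (by rwa [hrun0 hz])

end Certificate

/-! ### Chains of blocks. -/

/-- Reading of a signed permutation in one-line form: the entry `± (k + 1)` stands for the letter
`k` with the given sign. -/
def ofOneLine (l : List ℤ) (i : ℕ) : ℕ × Bool :=
  ((l.getD i 1).natAbs - 1, decide (l.getD i 1 < 0))

def shift (s : ℕ) (q : ℕ × Bool) : ℕ × Bool :=
  (q.1 + s, q.2)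

/-- The table of a signed permutation of a chain, which consists of a head, `m` copies of a block of
six letters and a tail. The entries of the blocks and of the tail are relative to the letter three
places before their beginning. -/
def chain (head block tail : List ℤ) (m p : ℕ) : ℕ × Bool :=
  if p < head.length then ofOneLine head p
  else if p < head.length + 6 * m then
    shift (p - (p - head.length) % 6 - 3) (ofOneLine block ((p - head.length) % 6))
  else shift (head.length + 6 * m - 3) (ofOneLine tail (p - (head.length + 6 * m)))

theorem chain_head {head block tail : List ℤ} {m p : ℕ} (h : p < head.length) :
    chain head block tail m p = ofOneLine head p :=
  if_pos h

theorem chain_block {head block tail : List ℤ} {m k j : ℕ} (h3 : 3 ≤ head.length) (hk : k < m)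
    (hj : j < 6) : chain head block tail m (head.length + 6 * k + j) =
      shift (head.length + 6 * k - 3) (ofOneLine block j) := by
  rw [chain, if_neg (by omega), if_pos (by omega)]
  have : (head.length + 6 * k + j - head.length) % 6 = j := by omega
  rw [this]
  congr 1
  omega

theorem chain_tail {head block tail : List ℤ} {m j : ℕ} :
    chain head block tail m (head.length + 6 * m + j) =
      shift (head.length + 6 * m - 3) (ofOneLine tail j) := by
  rw [chain, if_neg (by omega), if_neg (by omega), Nat.add_sub_cancel_left]

/-- Longer chains are locally translates of shorter ones. -/
theorem isTranslate_chain {head block tail : List ℤ} {m₀ m i lo hi : ℕ} (h3 : 3 ≤ head.length)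
    (hi0 : m₀ + i ≤ m) (hlo : i = 0 ∨ head.length ≤ lo)
    (hhi : m₀ + i = m ∨ hi ≤ head.length + 6 * m₀) :
    IsTranslate (chain head block tail m₀) (chain head block tail m) (6 * i) lo hi := by
  intro q hloq hqhi
  change _ = shift (6 * i) _
  -- A window reaching into the head is admitted only without shift, one reaching into the tail only
  -- when the shift accounts for all additional blocks; in between the chain is periodic.
  rcases lt_or_ge q head.length with hq | hq
  · obtain rfl : i = 0 := by omega
    rw [mul_zero, add_zero, chain_head hq, chain_head hq]
    rfl
  rcases lt_or_ge q (head.length + 6 * m₀) with hq' | hq'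
  · obtain ⟨k, j, hj, rfl⟩ : ∃ k j, j < 6 ∧ q = head.length + 6 * k + j :=
      ⟨(q - head.length) / 6, (q - head.length) % 6, Nat.mod_lt _ (by norm_num), by omega⟩
    have : head.length + 6 * k + j + 6 * i = head.length + 6 * (k + i) + j := by ring
    rw [this, chain_block h3 (by omega) hj, chain_block h3 (by omega) hj]
    refine Prod.ext ?_ rfl
    simp only [shift]
    omega
  · obtain ⟨j, rfl⟩ := Nat.exists_eq_add_of_le hq'
    obtain rfl : m₀ + i = m := by omega
    have : head.length + 6 * m₀ + j + 6 * i = head.length + 6 * (m₀ + i) + j := by ring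
    rw [this, chain_tail, chain_tail]
    refine Prod.ext ?_ rfl
    simp only [shift]
    omega

theorem prod_boolSign_chain {head block tail : List ℤ} (h3 : 3 ≤ head.length)
    (hblock : ∀ j < 6, (ofOneLine block j).2 = false) (m t : ℕ) :
    ∏ i ∈ Finset.range (head.length + 6 * m + t), boolSign (chain head block tail m i).2 =
      (∏ i ∈ Finset.range head.length, boolSign (ofOneLine head i).2) *
        ∏ i ∈ Finset.range t, boolSign (ofOneLine tail i).2 := by
  rw [Finset.prod_range_add, Finset.prod_range_add]
  have h1 : ∏ i ∈ Finset.range (6 * m),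
      boolSign (chain head block tail m (head.length + i)).2 = 1 := by
    refine Finset.prod_eq_one fun i hi => ?_
    have hi := Finset.mem_range.1 hi
    have : head.length + i = head.length + 6 * (i / 6) + i % 6 := by omega
    rw [this, chain_block h3 (by omega) (Nat.mod_lt _ (by norm_num)), shift,
      hblock _ (Nat.mod_lt _ (by norm_num))]
    rfl
  rw [h1, mul_one]
  congr 1
  · refine Finset.prod_congr rfl fun i hi => ?_
    rw [chain_head (Finset.mem_range.1 hi)]
  · refine Finset.prod_congr rfl fun i _ => ?_
    rw [chain_tail]
    rfl

theorem invProd_congr {f g : ℕ → ℕ} {n : ℕ} (h : ∀ i < n, f i = g i) :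
    invProd f n = invProd g n := by
  refine Finset.prod_congr rfl fun j hj => Finset.prod_congr rfl fun i hi => ?_
  have hj := Finset.mem_range.1 hj
  have hi := Finset.mem_range.1 hi
  rw [h i (hi.trans hj), h j hj]

theorem invProd_add_const (f : ℕ → ℕ) (c n : ℕ) : invProd (fun i => f i + c) n = invProd f n := by
  simp only [invProd, Nat.add_lt_add_iff_right]

/-- There are no inversions between the two segments. -/
theorem invProd_add {f : ℕ → ℕ} {a b : ℕ} (h : ∀ i < a, ∀ j < b, f i ≤ f (a + j)) :
    invProd f (a + b) = invProd f a * invProd (fun i => f (a + i)) b := by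
  rw [invProd, Finset.prod_range_add]
  congr 1
  refine Finset.prod_congr rfl fun j hj => ?_
  rw [Finset.prod_range_add, Finset.prod_eq_one, one_mul]
  intro i hi
  exact if_neg (h i (Finset.mem_range.1 hi) j (Finset.mem_range.1 hj)).not_gt

/-- The map preserves the head and each block, and a block is even, so the signature does not depend
on `m`. It is applied to the second generator; the first one links adjacent segments. -/
theorem invProd_chain {head block tail : List ℤ} {t : ℕ} (h3 : 3 ≤ head.length)
    (hhead : ∀ i < head.length, (ofOneLine head i).1 < head.length)
    (hblock : ∀ j < 6, 3 ≤ (ofOneLine block j).1 ∧ (ofOneLine block j).1 < 9)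
    (hblockinv : invProd (fun j => (ofOneLine block j).1) 6 = 1)
    (htail : ∀ j < t, 3 ≤ (ofOneLine tail j).1) (m : ℕ) :
    invProd (fun i => (chain head block tail m i).1) (head.length + 6 * m + t) =
      invProd (fun i => (ofOneLine head i).1) head.length *
        invProd (fun i => (ofOneLine tail i).1) t := by
  have hlt : ∀ k ≤ m, ∀ i < head.length + 6 * k,
      (chain head block tail m i).1 < head.length + 6 * k := by
    intro k hk i hi
    rcases lt_or_ge i head.length with h | h
    · rw [chain_head h]
      exact Nat.lt_add_right _ (hhead i h)
    · obtain ⟨l, j, hj, rfl⟩ : ∃ l j, j < 6 ∧ i = head.length + 6 * l + j :=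
        ⟨(i - head.length) / 6, (i - head.length) % 6, Nat.mod_lt _ (by norm_num), by omega⟩
      rw [chain_block h3 (by omega) hj, shift]
      have := (hblock j hj).2
      dsimp only
      omega
  have hpart : ∀ k ≤ m, invProd (fun i => (chain head block tail m i).1) (head.length + 6 * k) =
      invProd (fun i => (ofOneLine head i).1) head.length := by
    intro k
    induction k with
    | zero =>
      intro _
      refine invProd_congr fun i hi => ?_
      rw [chain_head (by omega)]
    | succ k ih =>
      intro hk
      have hval : ∀ j < 6, (chain head block tail m (head.length + 6 * k + j)).1 =
          (ofOneLine block j).1 + (head.length + 6 * k - 3) := fun j hj => by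
        rw [chain_block h3 (by omega) hj, shift]
      rw [Nat.mul_succ, ← add_assoc, invProd_add, ih (by omega), invProd_congr hval,
        invProd_add_const, hblockinv, mul_one]
      intro i hi j hj
      rw [hval j hj]
      have := hlt k (by omega) i hi
      have := (hblock j hj).1
      omega
  have hval : ∀ j < t, (chain head block tail m (head.length + 6 * m + j)).1 =
      (ofOneLine tail j).1 + (head.length + 6 * m - 3) := fun j _ => by rw [chain_tail, shift]
  rw [invProd_add, hpart m le_rfl, invProd_congr hval, invProd_add_const]
  intro i hi j hj
  rw [hval j hj]
  have := hlt m le_rfl i hi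
  have := htail j hj
  omega

/-- The first generator on a block: two transpositions, and links to both sides. -/
def blockX : List ℤ := [1, 8, 9, 10, 5, 6]

/-- The second generator on a block: a cycle of length four and a transposition. -/
def blockY : List ℤ := [5, 7, 4, 6, 9, 8]

namespace Certificate

/-- Validity of a certificate for a chain with three blocks, and with it for all longer ones. -/
def chainCheck (C : Certificate) (hx tx hy ty : List ℤ) : Bool :=
  decide (3 ≤ hx.length) && decide (hy.length = hx.length) && decide (ty.length = tx.length) &&
  C.check (chain hx blockX tx 3) (chain hy blockY ty 3) (hx.length + 6 * 3 + tx.length)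
    (hx.length + 6) (hx.length + 6 * 3) hx.length
    -- Letters of the head and the first block may see the head, those from the third block on may
    -- see the tail. The windows of the second block avoid both, so this block stands for all inner
    -- ones.
    (fun q => (if q < hx.length + 6 then 0 else hx.length,
      if q < hx.length + 12 then hx.length + 6 * 3 else hx.length + 6 * 3 + tx.length)) &&
  ((List.range hy.length).all fun i => decide ((ofOneLine hy i).1 < hy.length)) &&
  ((List.range ty.length).all fun i => decide (3 ≤ (ofOneLine ty i).1)) &&
  decide (invProd (fun i => (ofOneLine hy i).1) hy.length *
    invProd (fun i => (ofOneLine ty i).1) ty.length = -1) &&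
  decide ((∏ i ∈ Finset.range hy.length, boolSign (ofOneLine hy i).2) *
    ∏ i ∈ Finset.range ty.length, boolSign (ofOneLine ty i).2 = 1) &&
  decide ((∏ i ∈ Finset.range hx.length, boolSign (ofOneLine hx i).2) *
    ∏ i ∈ Finset.range tx.length, boolSign (ofOneLine tx i).2 ≠ 1)

theorem exists_generators_chain (C : Certificate) (hp : C.p.Prime) {hx tx hy ty : List ℤ}
    (hC : C.chainCheck hx tx hy ty = true) {n m : ℕ} (hm : 3 ≤ m)
    (hn : n = hx.length + 6 * m + tx.length) :
    ∃ X Y : Hyperoctahedral n, Subgroup.closure {X, Y} = ⊤ ∧ X ^ C.e₁ = 1 ∧ Y ^ C.e₂ = 1 ∧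
      (X * Y) ^ C.r = 1 ∧ X ≠ 1 ∧ ∀ v ∈ C.moving, wordElt X Y v ≠ 1 := by
  simp only [chainCheck, Bool.and_eq_true, decide_eq_true_eq, List.all_eq_true, List.mem_range]
    at hC
  obtain ⟨⟨⟨⟨⟨⟨⟨⟨h3, hlen⟩, htlen⟩, hcheck⟩, hhead⟩, htail⟩, hsign⟩, hyprod⟩, hxprod⟩ := hC
  have hyx : ∀ {i lo hi}, 3 + i ≤ m → (i = 0 ∨ hx.length ≤ lo) →
      (3 + i = m ∨ hi ≤ hx.length + 6 * 3) →
      IsTranslate (chain hx blockX tx 3) (chain hx blockX tx m) (6 * i) lo hi ∧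
      IsTranslate (chain hy blockY ty 3) (chain hy blockY ty m) (6 * i) lo hi :=
    fun h1 h2 h3' => ⟨isTranslate_chain h3 h1 h2 h3',
      isTranslate_chain (hlen ▸ h3) h1 (hlen ▸ h2) (hlen ▸ h3')⟩
  subst hn
  refine exists_generators C hp hcheck (x' := chain hx blockX tx m) (y' := chain hy blockY ty m)
    (t := 6 * (m - 3)) (by omega) (Or.inl (by omega)) ?_ ?_ ?_ ?_ ?_ ?_
  -- The head and the first block stay in place, inner blocks are translates of the second block,
  -- and the end of the chain is shifted by all `m - 3` additional blocks.
  · intro i hi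
    rcases lt_or_ge i (hx.length + 6) with h | h
    · refine ⟨i, 6 * 0, rfl, by omega, by omega, Or.inl rfl,
        hyx (by omega) (Or.inl rfl) (Or.inr ?_)⟩
      exact (if_pos (by omega)).le
    · set k := (i - (hx.length + 6)) / 6
      rcases lt_or_ge k (m - 3) with hk | hk
      · refine ⟨i - 6 * k, 6 * k, by omega, by omega, by omega, Or.inr (by omega),
          hyx (by omega) (Or.inr ?_) (Or.inr ?_)⟩
        · exact (if_neg (by omega)).ge
        · exact (if_pos (by omega)).le
      · refine ⟨i - 6 * (m - 3), 6 * (m - 3), by omega, by omega, le_rfl, Or.inr (by omega),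
          hyx (by omega) (Or.inr ?_) (Or.inl (by omega))⟩
        exact (if_neg (by omega)).ge
  · exact hyx (i := 0) (by omega) (Or.inl rfl) (Or.inr le_rfl)
  · exact hyx (by omega) (Or.inr le_rfl) (Or.inl (by omega))
  · rw [← hlen, ← htlen, invProd_chain (hlen ▸ h3) hhead (by decide) (by decide) htail, hsign]
  · rw [← hlen, ← htlen, prod_boolSign_chain (hlen ▸ h3) (by decide), hyprod]
  · rw [prod_boolSign_chain h3 (by decide)]
    exact hxprod

/-- Validity of a certificate for the tables `x` and `y` of two signed permutations. -/
def fullCheck (C : Certificate) (x y : ℕ → ℕ × Bool) (n : ℕ) : Bool :=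
  C.check x y n n n 0 (fun _ => (0, n)) && C.pureCheck x y n &&
  decide (invProd (fun i => (y i).1) n = -1) &&
  decide (∏ i ∈ Finset.range n, boolSign (y i).2 = 1) &&
  decide (∏ i ∈ Finset.range n, boolSign (x i).2 ≠ 1)

theorem exists_generators_of_fullCheck (C : Certificate) (hp : C.p.Prime) {x y : ℕ → ℕ × Bool}
    {n : ℕ} (hC : C.fullCheck x y n = true) :
    ∃ X Y : Hyperoctahedral n, Subgroup.closure {X, Y} = ⊤ ∧ X ^ C.e₁ = 1 ∧ Y ^ C.e₂ = 1 ∧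
      (X * Y) ^ C.r = 1 ∧ X ≠ 1 ∧ ∀ v ∈ C.moving, wordElt X Y v ≠ 1 := by
  simp only [fullCheck, pureCheck, Bool.and_eq_true, decide_eq_true_eq, List.all_eq_true,
    List.mem_range, Bool.or_eq_true] at hC
  obtain ⟨⟨⟨⟨hcheck, hpure⟩, hsign⟩, hyprod⟩, hxprod⟩ := hC
  exact exists_generators C hp hcheck (x' := x) (y' := y) (t := 0) rfl hpure
    (fun i hi => ⟨i, 0, rfl, hi, le_rfl, Or.inl rfl, fun _ _ _ => rfl, fun _ _ _ => rfl⟩)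
    ⟨fun _ _ _ => rfl, fun _ _ _ => rfl⟩ ⟨fun _ _ _ => rfl, fun _ _ _ => rfl⟩ hsign hyprod hxprod

end Certificate

end Hyperoctahedral

/-! ### Exact orders and the roles of the generators. -/

theorem orderOf_eq_four {G : Type*} [Group G] {g : G} (h4 : g ^ 4 = 1) (h2 : g ^ 2 ≠ 1) :
    orderOf g = 4 :=
  orderOf_eq_prime_pow (p := 2) (n := 1) h2 h4

theorem orderOf_eq_six {G : Type*} [Group G] {g : G} (h6 : g ^ 6 = 1) (h2 : g ^ 2 ≠ 1)
    (h3 : g ^ 3 ≠ 1) : orderOf g = 6 := by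
  refine orderOf_eq_of_pow_and_pow_div_prime (by norm_num) h6 fun p hp hdvd => ?_
  rcases hp.dvd_mul.1 (show p ∣ 2 * 3 from hdvd) with h | h
  · rw [(Nat.prime_dvd_prime_iff_eq hp Nat.prime_two).1 h]
    exact h3
  · rw [(Nat.prime_dvd_prime_iff_eq hp Nat.prime_three).1 h]
    exact h2

/-- The group is generated by two elements of orders `2` and `4` with a product of order `6`, and
hence is a quotient of the corresponding triangle group. -/
def IsTwoFourSix (G : Type*) [Group G] : Prop :=
  IsQuotientOf G (TriangleGroup 2 4 6) ∧ HasGeneratingPair G 2 4 6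

theorem isTwoFourSix_of_closure_eq_top {G : Type*} [Group G] {X Y : G}
    (h : Subgroup.closure {X, Y} = ⊤) (hX : X ^ 2 = 1) (hX1 : X ≠ 1) (hY : Y ^ 4 = 1)
    (hY2 : Y ^ 2 ≠ 1) (hXY : (X * Y) ^ 6 = 1) (hXY2 : (X * Y) ^ 2 ≠ 1) (hXY3 : (X * Y) ^ 3 ≠ 1) :
    IsTwoFourSix G :=
  ⟨isQuotientOf_of_closure_eq_top hX hY hXY h, X, Y, h, orderOf_eq_prime hX hX1,
    orderOf_eq_four hY hY2, orderOf_eq_six hXY hXY2 hXY3⟩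

namespace Hyperoctahedral

variable {n : ℕ} {X Y : Hyperoctahedral n}

theorem wordElt_wordPow_mul (k : ℕ) : wordElt X Y (wordPow [true, false] k) = (X * Y) ^ k := by
  rw [wordElt_wordPow, wordElt, wordElt, wordElt, one_mul]
  rfl

theorem isTwoFourSix_of_two_four (h : Subgroup.closure {X, Y} = ⊤ ∧ X ^ 2 = 1 ∧ Y ^ 4 = 1 ∧
    (X * Y) ^ 6 = 1 ∧ X ≠ 1 ∧ ∀ v ∈ [[true, true], wordPow [true, false] 2,
      wordPow [true, false] 3], wordElt X Y v ≠ 1) : IsTwoFourSix (Hyperoctahedral n) := by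
  obtain ⟨h, hX, hY, hXY, hX1, hv⟩ := h
  simp only [List.forall_mem_cons, wordElt_wordPow_mul] at hv
  refine isTwoFourSix_of_closure_eq_top h hX hX1 hY ?_ hXY hv.2.1 hv.2.2.1
  simpa [wordElt, pow_two] using hv.1

/-- The criterion is asymmetric: the second generator has to be odd with trivial product of signs,
the first needs a nontrivial product. This version serves pairs in which the involution comes
second; `Y * X` and `X * Y` are conjugate. -/
theorem isTwoFourSix_of_four_two (h : Subgroup.closure {X, Y} = ⊤ ∧ X ^ 4 = 1 ∧ Y ^ 2 = 1 ∧
    (X * Y) ^ 6 = 1 ∧ X ≠ 1 ∧ ∀ v ∈ [[true], [false, false], wordPow [true, false] 2,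
      wordPow [true, false] 3], wordElt X Y v ≠ 1) : IsTwoFourSix (Hyperoctahedral n) := by
  obtain ⟨h, hX, hY, hXY, -, hv⟩ := h
  simp only [List.forall_mem_cons, wordElt_wordPow_mul] at hv
  have hconj : ∀ k, (Y * X) ^ k = Y * (X * Y) ^ k * Y⁻¹ := fun k => by
    rw [← conj_pow]
    group
  have hconj1 : ∀ k, (Y * X) ^ k = 1 ↔ (X * Y) ^ k = 1 := fun k => by
    rw [hconj, conj_eq_one_iff]
  refine isTwoFourSix_of_closure_eq_top (by rwa [Set.pair_comm]) hY ?_ hX ?_ ((hconj1 _).2 hXY)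
    (mt (hconj1 _).1 hv.2.2.1) (mt (hconj1 _).1 hv.2.2.2.1)
  · simpa [wordElt] using hv.1
  · simpa [wordElt, pow_two] using hv.2.1

theorem closure_pair_mul (X Y : Hyperoctahedral n) :
    Subgroup.closure {X, Y} ≤ Subgroup.closure {X, X * Y} := by
  rw [Subgroup.closure_le]
  have hX : X ∈ Subgroup.closure {X, X * Y} := Subgroup.subset_closure (by simp)
  rintro g (rfl | rfl)
  · exact hX
  · exact (Subgroup.mul_mem_cancel_left _ hX).1 (Subgroup.subset_closure (by simp))

/-- Since `X` is an involution, the pair `X`, `X * Y` has product `Y`, which exchanges the orders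
`4` and `6`. -/
theorem isTwoFourSix_of_two_six (h : Subgroup.closure {X, Y} = ⊤ ∧ X ^ 2 = 1 ∧ Y ^ 6 = 1 ∧
    (X * Y) ^ 4 = 1 ∧ X ≠ 1 ∧ ∀ v ∈ [[true, true], [true, true, true], wordPow [true, false] 2],
      wordElt X Y v ≠ 1) : IsTwoFourSix (Hyperoctahedral n) := by
  obtain ⟨h, hX, hY, hXY, hX1, hv⟩ := h
  simp only [List.forall_mem_cons, wordElt_wordPow_mul] at hv
  have hXXY : X * (X * Y) = Y := by rw [← mul_assoc, ← pow_two, hX, one_mul]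
  refine isTwoFourSix_of_closure_eq_top (X := X) (Y := X * Y)
    (top_unique (h ▸ closure_pair_mul X Y)) hX hX1 hXY hv.2.2.1 ?_ ?_ ?_ <;> rw [hXXY]
  · exact hY
  · simpa [wordElt, pow_two] using hv.1
  · simpa [wordElt, pow_succ] using hv.2.1

/-! ### Explicit generators for the sporadic and the exceptional degrees. -/

/-- A certificate for generators of orders `2` and `4` with a product of order `6`. -/
def certificate (p : ℕ) (cycle : List Bool) (a : ℕ) (lengths : List ℕ) (signed : List Bool)
    (s : Bool) (f₁ f₂ : ℕ) : Certificate :=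
  ⟨2, 4, 6, p, cycle, a, lengths, [[true, true], wordPow [true, false] 2, wordPow [true, false] 3],
    0, signed, s, f₁, f₂⟩

theorem isTwoFourSix_three : IsTwoFourSix (Hyperoctahedral 3) := by
  obtain ⟨X, Y, h⟩ := Certificate.exists_generators_of_fullCheck
    (certificate 2 [false] 0 [1] [true, true] true 0 1)
    (by norm_num [certificate])
    (x := ofOneLine [2, 1, -3])
    (y := ofOneLine [3, -2, -1])
    (n := 3) (by decide +kernel)
  exact isTwoFourSix_of_two_four h

theorem isTwoFourSix_four : IsTwoFourSix (Hyperoctahedral 4) := by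
  obtain ⟨X, Y, h⟩ := Certificate.exists_generators_of_fullCheck
    (certificate 2 [false] 1 [1] [false, true, false, true, false, true] true 0 3)
    (by norm_num [certificate])
    (x := ofOneLine [-1, 4, 3, 2])
    (y := ofOneLine [2, 4, 1, 3])
    (n := 4) (by decide +kernel)
  exact isTwoFourSix_of_two_four h

theorem isQuotientOf_five : IsQuotientOf (Hyperoctahedral 5) (TriangleGroup 2 4 10) := by
  obtain ⟨X, Y, h, hX, hY, hXY, -⟩ := Certificate.exists_generators_of_fullCheck
    ⟨2, 4, 10, 2, [false], 2, [1], [], 0, [false], true, 1, 0⟩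
    (by norm_num)
    (x := ofOneLine [1, -2, 5, 4, 3])
    (y := ofOneLine [2, 4, 1, 3, 5])
    (n := 5) (by decide +kernel)
  exact isQuotientOf_of_closure_eq_top hX hY hXY h

theorem isQuotientOf_six : IsQuotientOf (Hyperoctahedral 6) (TriangleGroup 2 6 6) := by
  obtain ⟨X, Y, h, hX, hY, hXY, -⟩ := Certificate.exists_generators_of_fullCheck
    ⟨2, 6, 6, 3, [false, true], 3, [1, 2], [], 0, [false], true, 5, 4⟩
    (by norm_num)
    (x := ofOneLine [2, 1, 4, 3, 5, -6])
    (y := ofOneLine [3, 1, 5, 2, 6, 4])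
    (n := 6) (by decide +kernel)
  exact isQuotientOf_of_closure_eq_top hX hY hXY h

theorem isTwoFourSix_seven : IsTwoFourSix (Hyperoctahedral 7) := by
  obtain ⟨X, Y, h⟩ := Certificate.exists_generators_of_fullCheck
    ⟨4, 2, 6, 2, [false, false, false, true, false, true, false, true], 4, [5], [[true], [false,
      false], wordPow [true, false] 2, wordPow [true, false] 3], 1, [false, false], true, 5, 4⟩
    (by norm_num [certificate])
    (x := ofOneLine [2, 4, 1, 3, 5, 7, -6])
    (y := ofOneLine [-3, -5, -1, 6, -2, 4, 7])
    (n := 7) (by decide +kernel)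
  exact isTwoFourSix_of_four_two h

theorem isQuotientOf_eight : IsQuotientOf (Hyperoctahedral 8) (TriangleGroup 2 4 8) := by
  obtain ⟨X, Y, h, hX, hY, hXY, -⟩ := Certificate.exists_generators_of_fullCheck
    ⟨2, 8, 4, 3, [true, false, true], 2, [1, 4], [], 0, [false], true, 3, 2⟩
    (by norm_num)
    (x := ofOneLine [2, 1, 3, -4, 7, 8, 5, 6])
    (y := ofOneLine [-3, -4, -6, -1, 2, 8, 5, 7])
    (n := 8) (by decide +kernel)
  -- The certificate is of type `(2, 8, 4)`; passing to `X`, `X * Y` turns it into `(2, 4, 8)`.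
  have hXXY : X * (X * Y) = Y := by rw [← mul_assoc, ← pow_two, hX, one_mul]
  exact isQuotientOf_of_closure_eq_top hX hXY (by rwa [hXXY])
    (top_unique (h ▸ closure_pair_mul X Y))

theorem isTwoFourSix_nine : IsTwoFourSix (Hyperoctahedral 9) := by
  obtain ⟨X, Y, h⟩ := Certificate.exists_generators_of_fullCheck
    ⟨4, 2, 6, 5, [false, false, true], 1, [1, 2], [[true], [false, false], wordPow [true, false]
      2, wordPow [true, false] 3], 0, [true], true, 0, 2⟩
    (by norm_num [certificate])
    (x := ofOneLine [2, 3, 5, 6, 1, 7, 8, 4, -9])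
    (y := ofOneLine [-1, 4, 3, 2, -5, 8, 9, 6, 7])
    (n := 9) (by decide +kernel)
  exact isTwoFourSix_of_four_two h

theorem isTwoFourSix_twelve : IsTwoFourSix (Hyperoctahedral 12) := by
  obtain ⟨X, Y, h⟩ := Certificate.exists_generators_of_fullCheck
    (certificate 5 [false, true, false, true, true] 5 [1, 4] [false] true 11 2)
    (by norm_num [certificate])
    (x := ofOneLine [2, 1, 3, 7, 8, 10, 4, 5, 11, 6, 9, -12])
    (y := ofOneLine [3, 5, 7, 1, 9, 2, 4, 10, 6, 12, 8, 11])
    (n := 12) (by decide +kernel)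
  exact isTwoFourSix_of_two_four h

theorem isTwoFourSix_fourteen : IsTwoFourSix (Hyperoctahedral 14) := by
  obtain ⟨X, Y, h⟩ := Certificate.exists_generators_of_fullCheck
    ⟨2, 6, 4, 3, [true, false, true], 3, [11], [[true, true], [true, true, true], wordPow [true,
      false] 2], 0, [false], true, 4, 7⟩
    (by norm_num [certificate])
    (x := ofOneLine [2, 1, 7, 9, -5, 11, 3, 8, 4, 13, 6, 14, 10, 12])
    (y := ofOneLine [3, 5, 8, 1, -10, 2, 12, 13, 4, 14, -6, 7, 9, 11])
    (n := 14) (by decide +kernel)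
  exact isTwoFourSix_of_two_six h

theorem isTwoFourSix_fifteen : IsTwoFourSix (Hyperoctahedral 15) := by
  obtain ⟨X, Y, h⟩ := Certificate.exists_generators_of_fullCheck
    ⟨4, 2, 6, 5, [false, false, false, true, false, false, true, false, true], 3, [2, 6], [[true],
      [false, false], wordPow [true, false] 2, wordPow [true, false] 3], 1, [false, false], true,
      4, 14⟩
    (by norm_num [certificate])
    (x := ofOneLine [-2, 4, -1, 3, -7, 8, 5, 10, 12, 13, 14, 11, 6, 9, 15])
    (y := ofOneLine [3, 5, 1, 6, 2, 4, 9, 11, 7, 12, 8, 10, 13, 15, 14])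
    (n := 15) (by decide +kernel)
  exact isTwoFourSix_of_four_two h

/-! ### Explicit chains for the six residue classes modulo `6`. -/

theorem isTwoFourSix_add_10 {m : ℕ} : IsTwoFourSix (Hyperoctahedral (10 + 6 * m)) := by
  let hx : List ℤ := [1, 5, 4, 3]
  let tx : List ℤ := [1, 7, 9, 5, -8, 6]
  let hy : List ℤ := [3, 1, 4, 2]
  let ty : List ℤ := [5, 8, 4, 9, 6, 7]
  rcases lt_or_ge m 3 with h3 | h3
  · interval_cases m
    · obtain ⟨X, Y, h⟩ := Certificate.exists_generators_of_fullCheck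
        (certificate 3 [false, true, true, false, true] 1 [1, 4] [false] false 0 8)
        (by norm_num [certificate]) (x := chain hx blockX tx 0) (y := chain hy blockY ty 0)
        (n := 10) (by decide +kernel)
      exact isTwoFourSix_of_two_four h
    · obtain ⟨X, Y, h⟩ := Certificate.exists_generators_of_fullCheck
        (certificate 7 [false, true, false, true, true, true] 0 [3] [false] false 0 14)
        (by norm_num [certificate]) (x := chain hx blockX tx 1) (y := chain hy blockY ty 1)
        (n := 16) (by decide +kernel)
      exact isTwoFourSix_of_two_four h
    · obtain ⟨X, Y, h⟩ := Certificate.exists_generators_of_fullCheck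
        (certificate 7 [false, true, false, true, true, true] 0 [3] [false] false 0 20)
        (by norm_num [certificate]) (x := chain hx blockX tx 2) (y := chain hy blockY ty 2)
        (n := 22) (by decide +kernel)
      exact isTwoFourSix_of_two_four h
  -- The `7`-cycle lives in the head and the first block. Every other letter returns after three
  -- applications of the word, however many blocks there are; the signed letter `26` lies in the
  -- tail and moves with it.
  · obtain ⟨X, Y, h⟩ := Certificate.exists_generators_chain
      (certificate 7 [false, true, false, true, true, true] 0 [3] [false] false 0 26)
      (by norm_num [certificate]) (hx := hx) (tx := tx) (hy := hy) (ty := ty)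
      (by decide +kernel) h3 (n := 10 + 6 * m) (by simp only [hx, tx, List.length]; omega)
    exact isTwoFourSix_of_two_four h

theorem isTwoFourSix_add_11 {m : ℕ} : IsTwoFourSix (Hyperoctahedral (11 + 6 * m)) := by
  let hx : List ℤ := [2, 1, 5, 7, 3, 9, 4, -8]
  let tx : List ℤ := [1, 6, 5]
  let hy : List ℤ := [3, 4, 7, 5, 8, 1, 6, 2]
  let ty : List ℤ := [-5, 4, -6]
  rcases lt_or_ge m 3 with h3 | h3
  · interval_cases m
    · obtain ⟨X, Y, h⟩ := Certificate.exists_generators_of_fullCheck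
        (certificate 2 [false, true, true] 9 [9] [true, true] true 8 10)
        (by norm_num [certificate]) (x := chain hx blockX tx 0) (y := chain hy blockY ty 0)
        (n := 11) (by decide +kernel)
      exact isTwoFourSix_of_two_four h
    · obtain ⟨X, Y, h⟩ := Certificate.exists_generators_of_fullCheck
        (certificate 7 [false, true, false, true, true, true, false, true] 2 [2, 3, 5] [true,
          true] false 12 14)
        (by norm_num [certificate]) (x := chain hx blockX tx 1) (y := chain hy blockY ty 1)
        (n := 17) (by decide +kernel)
      exact isTwoFourSix_of_two_four h
    · obtain ⟨X, Y, h⟩ := Certificate.exists_generators_of_fullCheck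
        (certificate 11 [false, true, false, true, true, true] 0 [3] [true, true] false 12 20)
        (by norm_num [certificate]) (x := chain hx blockX tx 2) (y := chain hy blockY ty 2)
        (n := 23) (by decide +kernel)
      exact isTwoFourSix_of_two_four h
  · obtain ⟨X, Y, h⟩ := Certificate.exists_generators_chain
      (certificate 11 [false, true, false, true, true, true] 0 [3] [true, true] false 12 26)
      (by norm_num [certificate]) (hx := hx) (tx := tx) (hy := hy) (ty := ty)
      (by decide +kernel) h3 (n := 11 + 6 * m) (by simp only [hx, tx, List.length]; omega)
    exact isTwoFourSix_of_two_four h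

theorem isTwoFourSix_add_12 {m : ℕ} (hm : 1 ≤ m) : IsTwoFourSix (Hyperoctahedral (12 + 6 * m)) := by
  let hx : List ℤ := [1, 5, 4, 3]
  let tx : List ℤ := [1, 7, 9, 5, 11, 6, -10, 8]
  let hy : List ℤ := [3, 1, 4, 2]
  let ty : List ℤ := [5, 8, 4, 9, 6, 11, 7, 10]
  rcases lt_or_ge m 3 with h3 | h3
  · interval_cases m
    · obtain ⟨X, Y, h⟩ := Certificate.exists_generators_of_fullCheck
        (certificate 7 [false, true, false, true, true, true] 0 [11] [false] false 0 16)
        (by norm_num [certificate]) (x := chain hx blockX tx 1) (y := chain hy blockY ty 1)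
        (n := 18) (by decide +kernel)
      exact isTwoFourSix_of_two_four h
    · obtain ⟨X, Y, h⟩ := Certificate.exists_generators_of_fullCheck
        (certificate 7 [false, true, false, true, true, true] 0 [3, 11] [false] false 0 22)
        (by norm_num [certificate]) (x := chain hx blockX tx 2) (y := chain hy blockY ty 2)
        (n := 24) (by decide +kernel)
      exact isTwoFourSix_of_two_four h
  · obtain ⟨X, Y, h⟩ := Certificate.exists_generators_chain
      (certificate 7 [false, true, false, true, true, true] 0 [3, 11] [false] false 0 28)
      (by norm_num [certificate]) (hx := hx) (tx := tx) (hy := hy) (ty := ty)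
      (by decide +kernel) h3 (n := 12 + 6 * m) (by simp only [hx, tx, List.length]; omega)
    exact isTwoFourSix_of_two_four h

theorem isTwoFourSix_add_13 {m : ℕ} : IsTwoFourSix (Hyperoctahedral (13 + 6 * m)) := by
  let hx : List ℤ := [-1, 5, 4, 3]
  let tx : List ℤ := [1, 7, 9, 5, 8, 6, 12, 11, 10]
  let hy : List ℤ := [3, -1, -4, 2]
  let ty : List ℤ := [5, 8, 4, 9, 6, 11, 7, 10, 12]
  rcases lt_or_ge m 3 with h3 | h3
  · interval_cases m
    · obtain ⟨X, Y, h⟩ := Certificate.exists_generators_of_fullCheck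
        (certificate 7 [false, true, true] 5 [6] [false] true 0 8)
        (by norm_num [certificate]) (x := chain hx blockX tx 0) (y := chain hy blockY ty 0)
        (n := 13) (by decide +kernel)
      exact isTwoFourSix_of_two_four h
    · obtain ⟨X, Y, h⟩ := Certificate.exists_generators_of_fullCheck
        (certificate 7 [false, true, false, true, true, true] 0 [3, 9] [false] true 0 14)
        (by norm_num [certificate]) (x := chain hx blockX tx 1) (y := chain hy blockY ty 1)
        (n := 19) (by decide +kernel)
      exact isTwoFourSix_of_two_four h
    · obtain ⟨X, Y, h⟩ := Certificate.exists_generators_of_fullCheck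
        (certificate 7 [false, true, false, true, true, true] 0 [3, 9] [false] true 0 20)
        (by norm_num [certificate]) (x := chain hx blockX tx 2) (y := chain hy blockY ty 2)
        (n := 25) (by decide +kernel)
      exact isTwoFourSix_of_two_four h
  · obtain ⟨X, Y, h⟩ := Certificate.exists_generators_chain
      (certificate 7 [false, true, false, true, true, true] 0 [3, 9] [false] true 0 26)
      (by norm_num [certificate]) (hx := hx) (tx := tx) (hy := hy) (ty := ty)
      (by decide +kernel) h3 (n := 13 + 6 * m) (by simp only [hx, tx, List.length]; omega)
    exact isTwoFourSix_of_two_four h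

theorem isTwoFourSix_add_20 {m : ℕ} : IsTwoFourSix (Hyperoctahedral (20 + 6 * m)) := by
  let hx : List ℤ := [2, 1, 5, 7, 3, 9, 4, -8]
  let tx : List ℤ := [1, 7, 9, 5, 11, 6, 12, 8, 10, 15, 14, 13]
  let hy : List ℤ := [3, 4, 7, 5, 8, 1, 6, 2]
  let ty : List ℤ := [5, 8, 4, 9, 6, 11, 7, 10, 13, 15, 12, 14]
  rcases lt_or_ge m 3 with h3 | h3
  · interval_cases m
    · obtain ⟨X, Y, h⟩ := Certificate.exists_generators_of_fullCheck
        (certificate 7 [false, true, false, true, true, true] 5 [13] [false] true 7 18)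
        (by norm_num [certificate]) (x := chain hx blockX tx 0) (y := chain hy blockY ty 0)
        (n := 20) (by decide +kernel)
      exact isTwoFourSix_of_two_four h
    · obtain ⟨X, Y, h⟩ := Certificate.exists_generators_of_fullCheck
        (certificate 11 [false, true, false, true, true, true] 0 [15] [false] true 7 24)
        (by norm_num [certificate]) (x := chain hx blockX tx 1) (y := chain hy blockY ty 1)
        (n := 26) (by decide +kernel)
      exact isTwoFourSix_of_two_four h
    · obtain ⟨X, Y, h⟩ := Certificate.exists_generators_of_fullCheck
        (certificate 11 [false, true, false, true, true, true] 0 [3, 15] [false] true 7 30)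
        (by norm_num [certificate]) (x := chain hx blockX tx 2) (y := chain hy blockY ty 2)
        (n := 32) (by decide +kernel)
      exact isTwoFourSix_of_two_four h
  · obtain ⟨X, Y, h⟩ := Certificate.exists_generators_chain
      (certificate 11 [false, true, false, true, true, true] 0 [3, 15] [false] true 7 36)
      (by norm_num [certificate]) (hx := hx) (tx := tx) (hy := hy) (ty := ty)
      (by decide +kernel) h3 (n := 20 + 6 * m) (by simp only [hx, tx, List.length]; omega)
    exact isTwoFourSix_of_two_four h

theorem isTwoFourSix_add_21 {m : ℕ} : IsTwoFourSix (Hyperoctahedral (21 + 6 * m)) := by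
  let hx : List ℤ := [2, 1, 5, 6, 3, 4, 10, 8, 9]
  let tx : List ℤ := [1, 7, 9, 5, 11, 6, 13, 8, 14, 10, 12, -15]
  let hy : List ℤ := [3, 4, 6, 8, 5, 7, 1, 9, 2]
  let ty : List ℤ := [5, 8, 4, 9, 6, 12, 7, 13, 10, 15, 11, 14]
  rcases lt_or_ge m 3 with h3 | h3
  · interval_cases m
    · obtain ⟨X, Y, h⟩ := Certificate.exists_generators_of_fullCheck
        (certificate 7 [false, true, true] 2 [4, 6] [false] false 7 20)
        (by norm_num [certificate]) (x := chain hx blockX tx 0) (y := chain hy blockY ty 0)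
        (n := 21) (by decide +kernel)
      exact isTwoFourSix_of_two_four h
    · obtain ⟨X, Y, h⟩ := Certificate.exists_generators_of_fullCheck
        (certificate 7 [false, true, false, true, true, true] 3 [1, 2, 3, 9] [false] false 7 26)
        (by norm_num [certificate]) (x := chain hx blockX tx 1) (y := chain hy blockY ty 1)
        (n := 27) (by decide +kernel)
      exact isTwoFourSix_of_two_four h
    · obtain ⟨X, Y, h⟩ := Certificate.exists_generators_of_fullCheck
        (certificate 7 [false, true, false, true, true, true] 3 [1, 2, 3, 9] [false] false 7 32)
        (by norm_num [certificate]) (x := chain hx blockX tx 2) (y := chain hy blockY ty 2)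
        (n := 33) (by decide +kernel)
      exact isTwoFourSix_of_two_four h
  · obtain ⟨X, Y, h⟩ := Certificate.exists_generators_chain
      (certificate 7 [false, true, false, true, true, true] 3 [1, 2, 3, 9] [false] false 7 38)
      (by norm_num [certificate]) (hx := hx) (tx := tx) (hy := hy) (ty := ty)
      (by decide +kernel) h3 (n := 21 + 6 * m) (by simp only [hx, tx, List.length]; omega)
    exact isTwoFourSix_of_two_four h

end Hyperoctahedral

/-! ### Assembly of all degrees. -/

theorem theorem1 :
    (∀ n : ℕ, 3 ≤ n → n ≠ 5 → n ≠ 6 → n ≠ 8 →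
      IsQuotientOf (Hyperoctahedral n) (TriangleGroup 2 4 6) ∧
        HasGeneratingPair (Hyperoctahedral n) 2 4 6) ∧
    IsQuotientOf (Hyperoctahedral 5) (TriangleGroup 2 4 10) ∧
    IsQuotientOf (Hyperoctahedral 6) (TriangleGroup 2 6 6) ∧
    IsQuotientOf (Hyperoctahedral 8) (TriangleGroup 2 4 8) := by
  refine ⟨fun n h3 h5 h6 h8 => ?_, Hyperoctahedral.isQuotientOf_five,
    Hyperoctahedral.isQuotientOf_six, Hyperoctahedral.isQuotientOf_eight⟩
  change IsTwoFourSix (Hyperoctahedral n)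
  -- The six chains start at one degree in each residue class modulo `6`; the sporadic degrees are
  -- the admissible ones below these starting points, where the third family starts at `18`.
  have hsmall : n = 3 ∨ n = 4 ∨ n = 7 ∨ n = 9 ∨ n = 12 ∨ n = 14 ∨ n = 15 ∨
      (∃ m, n = 10 + 6 * m) ∨ (∃ m, n = 11 + 6 * m) ∨ (∃ m, 1 ≤ m ∧ n = 12 + 6 * m) ∨
      (∃ m, n = 13 + 6 * m) ∨ (∃ m, n = 20 + 6 * m) ∨ ∃ m, n = 21 + 6 * m := by
    by_contra! h
    have := h.2.2.2.2.2.2.2.1 ((n - 10) / 6)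
    have := h.2.2.2.2.2.2.2.2.1 ((n - 11) / 6)
    have := h.2.2.2.2.2.2.2.2.2.1 ((n - 12) / 6)
    have := h.2.2.2.2.2.2.2.2.2.2.1 ((n - 13) / 6)
    have := h.2.2.2.2.2.2.2.2.2.2.2.1 ((n - 20) / 6)
    have := h.2.2.2.2.2.2.2.2.2.2.2.2 ((n - 21) / 6)
    omega
  rcases hsmall with rfl | rfl | rfl | rfl | rfl | rfl | rfl | ⟨m, rfl⟩ | ⟨m, rfl⟩ | ⟨m, hm, rfl⟩ |
    ⟨m, rfl⟩ | ⟨m, rfl⟩ | ⟨m, rfl⟩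
  · exact Hyperoctahedral.isTwoFourSix_three
  · exact Hyperoctahedral.isTwoFourSix_four
  · exact Hyperoctahedral.isTwoFourSix_seven
  · exact Hyperoctahedral.isTwoFourSix_nine
  · exact Hyperoctahedral.isTwoFourSix_twelve
  · exact Hyperoctahedral.isTwoFourSix_fourteen
  · exact Hyperoctahedral.isTwoFourSix_fifteen
  · exact Hyperoctahedral.isTwoFourSix_add_10
  · exact Hyperoctahedral.isTwoFourSix_add_11
  · exact Hyperoctahedral.isTwoFourSix_add_12 hm
  · exact Hyperoctahedral.isTwoFourSix_add_13
  · exact Hyperoctahedral.isTwoFourSix_add_20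
  · exact Hyperoctahedral.isTwoFourSix_add_21
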